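/- Let $X_1,X_2,\dots$ be i.i.d. real random variables with distribution function $F$ whose tail quantile function $U(x)=\inf\{y: F(y)\ge 1-1/x\}$, $x>1$, satisfies $U(x)=x^{\gamma}\ell(x)$ for all large $x$, with $\gamma>0$. Suppose that $\ell$ is slowly varying at infinity, i.e. $\ell$ is eventually positive and $\lim_{t\to\infty}\ell(xt)/\ell(t)=1$ for every $x>0$, and that it satisfies the second-order condition: there are $\rho\le 0$ and a rate function $b$ with $b(x)\to0$ as $x\to\infty$ such that, for every $u\ge1$, $$\lim_{x\to\infty}\frac{\log\left(\ell(xu)/\ell(x)\right)}{b(x)}=h_\rho(u):=\int_1^u y^{\rho-1}\,dy .$$ Let $\theta_1,\theta_2,\dots$ be i.i.d. uniform on $(0,1)$, independent of the sample. Let $k=k(n)$ be integers with $k\to\infty$ and $k/n\to0$ as $n\to\infty$, and let $\alpha(k)$ satisfy $\lim_{k\to\infty}\alpha(k)/k=\Delta\in(0,\infty)$. Let $\hat\rho=\hat\rho_n$ be a consistent estimator of $\rho$ (that is, $\hat\rho_n\to\rho$ in probability), and let $\lambda=\lambda_n\ge0$ be a penalty, which may be random and may depend on the data and on the $\theta_j$.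 With $X_{1,n}\le\dots\le X_{n,n}$ the order statistics of $X_1,\dots,X_n$, put for $1\le j\le k$ $$T_j=j\left(\log X_{n-j+1,n}-\log X_{n-j,n}\right),\quad C_j=\Big(\frac{j}{k+1}\Big)^{-\hat\rho},\quad W_j=1-\theta_j^{\alpha(k)}\frac{j}{k+1},\quad \tilde W_j=\frac{W_j}{\sum_{i=1}^kW_i},$$ $\kappa(a)=(a+1)/(2a+1)$, $S_1=\sum_{j=1}^k\tilde W_jC_j$, and $$\hat b_{n,k}=\frac{\sum_{j=1}^k\tilde W_j(C_j-S_1)T_j}{2\kappa(\alpha(k))\lambda+\sum_{j=1}^k\tilde W_jC_j^2-S_1^2},\qquad \hat\gamma_{RW}=\sum_{j=1}^k\tilde W_jT_j-\hat b_{n,k}S_1$$ (a quotient with denominator $0$ being read as $0$). Suppose that $\sqrt k\,b_{n,k}\to0$ both for the slope $b_{n,k}=b(n/k)$ and, in probability, for its estimate, that is, $$\sqrt k\,b(n/k)\to0\quad\text{and}\quad\sqrt k\,\hat b_{n,k}\to0\ \text{ in probability, as } n\to\infty.$$ Then $$\frac{\sqrt k\,(\hat\gamma_{RW}-\gamma)}{\gamma}\longrightarrow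 N(0,1)\quad\text{in distribution, as } n\to\infty .$$ -/

import Mathlib

open Filter Topology MeasureTheory ProbabilityTheory

noncomputable section

/-- The tail quantile function `U(x) = inf {y : F(y) ≥ 1 - 1/x}`, `x > 1`, of the distribution `μ`
on `ℝ` with distribution function `F = cdf μ`. -/
def tailQuantile (μ : Measure ℝ) (x : ℝ) : ℝ :=
  sInf {y : ℝ | 1 - 1 / x ≤ cdf μ y}

/-- `ℓ` is slowly varying at infinity: it is eventually positive, and `ℓ(xt)/ℓ(t) → 1` as `t → ∞`
for every `x > 0`. (Measurability is not asked for.) -/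
def IsSlowlyVarying (ℓ : ℝ → ℝ) : Prop :=
  (∀ᶠ t in atTop, 0 < ℓ t) ∧ ∀ x : ℝ, 0 < x → Tendsto (fun t => ℓ (x * t) / ℓ t) atTop (𝓝 1)

/-- `h_ρ(u) = ∫_1^u y^(ρ-1) dy`. -/
def hRho (ρ u : ℝ) : ℝ := ∫ y in (1 : ℝ)..u, y ^ (ρ - 1)

/-- The second-order condition with rate function `b` and second-order parameter `ρ ≤ 0`:
`b(x) → 0`, and `log (ℓ(xu)/ℓ(x)) ~ b(x) h_ρ(u)` as `x → ∞`, for every `u ≥ 1`. -/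
def SecondOrderCondition (ℓ b : ℝ → ℝ) (ρ : ℝ) : Prop :=
  ρ ≤ 0 ∧ Tendsto b atTop (𝓝 0) ∧
    ∀ u : ℝ, 1 ≤ u →
      Tendsto (fun x => Real.log (ℓ (x * u) / ℓ x) / b x) atTop (𝓝 (hRho ρ u))

/-- The `m`-th smallest of the `n` numbers `x 0, …, x (n-1)`, for `1 ≤ m ≤ n`
(and `0` for other values of `m`). -/
def orderStat {n : ℕ} (x : Fin n → ℝ) (m : ℕ) : ℝ :=
  if h : 1 ≤ m ∧ m ≤ n then x (Tuple.sort x ⟨m - 1, by omega⟩) else 0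

/-- The weighted log-spacing `T_j = j (log X_{n-j+1,n} - log X_{n-j,n})`, for `1 ≤ j < n`. -/
def logSpacing {n : ℕ} (x : Fin n → ℝ) (j : ℕ) : ℝ :=
  j * (Real.log (orderStat x (n - j + 1)) - Real.log (orderStat x (n - j)))

/-- The random weight `W_j = 1 - θ_j^a j/(k+1)`, where `a` stands for `α(k)`. -/
def weight (k : ℕ) (a : ℝ) (θ : ℕ → ℝ) (j : ℕ) : ℝ :=
  1 - θ j ^ a * ((j : ℝ) / (k + 1))

/-- The normalised weight `W̃_j = W_j / ∑_i W_i`. -/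
def normWeight (k : ℕ) (a : ℝ) (θ : ℕ → ℝ) (j : ℕ) : ℝ :=
  weight k a θ j / ∑ i ∈ Finset.Icc 1 k, weight k a θ i

/-- The covariate `C_j = (j/(k+1))^(-r)`. -/
def covariate (k : ℕ) (r : ℝ) (j : ℕ) : ℝ := ((j : ℝ) / (k + 1)) ^ (-r)

/-- `κ(a) = (a+1)/(2a+1)`. -/
def kappa (a : ℝ) : ℝ := (a + 1) / (2 * a + 1)

/-- The weighted mean of the covariates, `∑_j W̃_j C_j`. -/
def weightedMeanC (k : ℕ) (a : ℝ) (θ : ℕ → ℝ) (r : ℝ) : ℝ :=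
  ∑ j ∈ Finset.Icc 1 k, normWeight k a θ j * covariate k r j

/-- The regularised weighted least squares estimate of the slope,
`∑_j W̃_j (C_j - ∑ W̃ C) T_j / (2 κ(a) lam + ∑_j W̃_j C_j² - (∑ W̃ C)²)`,
with penalty `lam` and second-order parameter `r`. -/
def bHat {n : ℕ} (x : Fin n → ℝ) (k : ℕ) (a : ℝ) (θ : ℕ → ℝ) (r lam : ℝ) : ℝ :=
  (∑ j ∈ Finset.Icc 1 k,
      normWeight k a θ j * (covariate k r j - weightedMeanC k a θ r) * logSpacing x j) /
    (2 * kappa a * lam + ∑ j ∈ Finset.Icc 1 k, normWeight k a θ j * covariate k r j ^ 2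
      - weightedMeanC k a θ r ^ 2)

/-- The regularised weighted least squares estimator of the tail index,
`∑_j W̃_j T_j - b̂ ∑_j W̃_j C_j`. -/
def gammaRW {n : ℕ} (x : Fin n → ℝ) (k : ℕ) (a : ℝ) (θ : ℕ → ℝ) (r lam : ℝ) : ℝ :=
  ∑ j ∈ Finset.Icc 1 k, normWeight k a θ j * logSpacing x j
    - bHat x k a θ r lam * weightedMeanC k a θ r

end

/-! The weights are almost constant. For `θ_j` uniform, `θ_j ^ a` has mean `1 / (a + 1)`, and `a =
α(k)` grows like `Δ k`, so the `k` defects `θ_j ^ a * j / (k + 1)` add up to `O_P(1)`. The weighted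
mean of the `T_j` is thus the Hill estimator up to `O_P(1/k)`. The correction is `o_P(1/√k)`: `√k`
times the slope estimate vanishes by hypothesis, and the weighted mean of the covariates stays
bounded when the estimate of `ρ` is at most `1/2`, a likely event since `ρ ≤ 0`
(`abs_gammaRW_sub_hillSum_le`, `measureReal_sum_rpow_mul_ge_le`). What remains is asymptotic
normality of the Hill estimator.

In law the sample is `U(e^E_i)` with `E_i` standard exponential, so `log X_i = γ E_i + L(E_i)`,
where `L(s) = log ℓ(e^s)` for large `s`. The linear part contributes `γ` times a sum of `k`
normalised exponential spacings. By Rényi's representation (`map_sort_pi_expMeasure`) this has the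
law of `γ` times a sum of `k` independent exponentials, and the central limit theorem applies. After
Abel summation the part from `L` is a sum of increments of `L` above a high threshold, each bounded
by a multiple of `|b(n/k)| e^(u/2)` at excess `u`. Their sum is `O_P(k |b(n/k)|)`, negligible
against `√k` because `√k b(n/k) → 0`.

That bound must be uniform in `u`, while the second-order condition is pointwise and neither `ℓ` nor
`b` is assumed measurable. But `L` is measurable because `U` is monotone, and a measure argument in
the style of the uniform convergence theorem for regular variation gives uniformity
(`exists_increment_bound_of_secondOrder`). -/

/-! ### Uniform increment bounds from the second-order condition -/

/-- Csiszár–Erdős argument: pointwise `O`-bounds on the increments of a measurable function are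
locally uniform. -/
lemma exists_increment_bound_of_pointwise {g c : ℝ → ℝ} (hg : Measurable g)
    (hc : ∀ᶠ s in atTop, 0 ≤ c s) {K : ℝ}
    (hK : ∀ᶠ s in atTop, ∀ u ∈ Set.Icc (0 : ℝ) 1, c (s + u) ≤ K * c s)
    (hbd : ∀ u : ℝ, 0 ≤ u → ∃ M : ℝ, ∀ᶠ s in atTop, |g (s + u) - g s| ≤ M * c s) :
    ∃ C : ℝ, ∀ᶠ s in atTop, ∀ u ∈ Set.Icc (0 : ℝ) 1, |g (s + u) - g s| ≤ C * c s := by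
  by_contra hcon
  push Not at hcon
  have hex : ∀ n : ℕ, ∃ s : ℝ, (n : ℝ) ≤ s ∧ ∃ u ∈ Set.Icc (0 : ℝ) 1,
      (n : ℝ) * c s < |g (s + u) - g s| := by
    intro n
    obtain ⟨s, ⟨u, hu, h⟩, hs⟩ := ((hcon n).and_eventually (eventually_ge_atTop (n : ℝ))).exists
    exact ⟨s, hs, u, hu, h⟩
  choose s hs u hu hlt using hex
  have hst : Tendsto s atTop atTop := tendsto_atTop_mono hs tendsto_natCast_atTop_atTop
  have hyt : Tendsto (fun n => s n + u n) atTop atTop :=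
    tendsto_atTop_mono (fun n => by linarith [hs n, (hu n).1]) tendsto_natCast_atTop_atTop
  have hm : ∀ (y : ℕ → ℝ) (N : ℕ), MeasurableSet
      {v : ℝ | ∀ n ≥ N, |g (y n + v) - g (y n)| ≤ N * c (y n)} := by
    intro y N
    simp only [Set.ofPred_forall]
    refine MeasurableSet.iInter fun n => MeasurableSet.iInter fun _ => ?_
    exact measurableSet_le (by fun_prop) measurable_const
  -- Once `c (y n) ≥ 0`, the sets of good shifts `v` increase with `N`; by the pointwise bounds they
  -- exhaust `[0, T]`, so their measures tend to full measure.
  have key : ∀ y : ℕ → ℝ, Tendsto y atTop atTop → ∀ T : ℝ,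
      Tendsto (fun N : ℕ => volume (Set.Icc 0 T ∩
        {v : ℝ | ∀ n ≥ N, |g (y n + v) - g (y n)| ≤ N * c (y n)})) atTop
        (𝓝 (volume (Set.Icc 0 T))) := by
    intro y hy T
    have hmono : ∀ᶠ n in atTop, 0 ≤ c (y n) := hy.eventually hc
    obtain ⟨N0, hN0⟩ := eventually_atTop.1 hmono
    let V : ℕ → Set ℝ := fun N => Set.Icc 0 T ∩
        {v : ℝ | ∀ n ≥ N + N0, |g (y n + v) - g (y n)| ≤ (N + N0 : ℕ) * c (y n)}
    have hVmono : Monotone V := by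
      intro a b hab v hv
      refine ⟨hv.1, fun n hn => (hv.2 n (by omega)).trans ?_⟩
      exact mul_le_mul_of_nonneg_right (by exact_mod_cast (by omega)) (hN0 n (by omega))
    have hVU : ⋃ N, V N = Set.Icc 0 T := by
      refine Set.Subset.antisymm (Set.iUnion_subset fun N => Set.inter_subset_left) ?_
      intro v hv
      obtain ⟨M, hM⟩ := hbd v hv.1
      obtain ⟨N1, hN1⟩ := eventually_atTop.1 (hy.eventually hM)
      obtain ⟨N2, hN2⟩ := exists_nat_ge M
      refine Set.mem_iUnion.2 ⟨N1 + N2, hv, fun n hn => (hN1 n (by omega)).trans ?_⟩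
      refine mul_le_mul_of_nonneg_right (hN2.trans ?_) (hN0 n (by omega))
      exact_mod_cast (by omega)
    have := tendsto_measure_iUnion_atTop (μ := (volume : Measure ℝ)) hVmono
    rw [hVU] at this
    exact (tendsto_add_atTop_iff_nat N0).1 this
  have h1 := key s hst 2
  have h2 := key (fun n => s n + u n) hyt 1
  rw [Real.volume_Icc] at h1 h2
  have e1 := h1.eventually (lt_mem_nhds (a := ENNReal.ofReal (3/2))
    ((ENNReal.ofReal_lt_ofReal_iff (by norm_num)).2 (by norm_num)))
  have e2 := h2.eventually (lt_mem_nhds (a := ENNReal.ofReal (1/2))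
    ((ENNReal.ofReal_lt_ofReal_iff (by norm_num)).2 (by norm_num)))
  obtain ⟨N, hN1, hN2⟩ := (e1.and e2).exists
  obtain ⟨n0, hn0⟩ := exists_nat_ge ((N : ℝ) * (1 + K))
  obtain ⟨n, ⟨hcn, hKn⟩, hn⟩ := ((hst.eventually (hc.and hK)).and
    (eventually_ge_atTop (N + n0))).exists
  have hmeet : ((Set.Icc (0:ℝ) 2 ∩ {v : ℝ | ∀ n ≥ N, |g (s n + v) - g (s n)| ≤ N * c (s n)}) ∩
      ((fun v => v + (- u n)) ⁻¹' (Set.Icc (0:ℝ) 1 ∩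
        {w : ℝ | ∀ n ≥ N, |g (s n + u n + w) - g (s n + u n)|
        ≤ N * c (s n + u n)}))).Nonempty := by
    refine nonempty_inter_of_measure_lt_add volume (u := Set.Icc (0:ℝ) 2) ?_
      Set.inter_subset_left ?_ ?_
    · exact (measurableSet_Icc.inter (hm (fun n => s n + u n) N)).preimage (by fun_prop)
    · rintro v ⟨hv, -⟩
      have := (hu n).1
      have := (hu n).2
      simp only [Set.mem_Icc] at hv ⊢
      constructor <;> linarith
    · rw [measure_preimage_add_right, Real.volume_Icc]
      calc ENNReal.ofReal (2 - 0) = ENNReal.ofReal (3/2) + ENNReal.ofReal (1/2) := by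
            rw [← ENNReal.ofReal_add (by norm_num) (by norm_num)]; norm_num
        _ < _ := ENNReal.add_lt_add hN1 hN2
  obtain ⟨v, ⟨-, hv⟩, -, hw⟩ := hmeet
  have hv' := hv n (by omega)
  have hw' := hw n (by omega)
  rw [show s n + u n + (v + -u n) = s n + v by ring] at hw'
  have h3 : |g (s n + u n) - g (s n)| ≤ N * c (s n) + N * (K * c (s n)) := by
    have := hKn (u n) (hu n)
    have h4 : (N : ℝ) * c (s n + u n) ≤ N * (K * c (s n)) := by gcongr
    have h5 := abs_sub_le (g (s n + u n)) (g (s n + v)) (g (s n))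
    rw [abs_sub_comm (g (s n + u n)) (g (s n + v))] at h5
    linarith
  have h6 : (N : ℝ) * (1 + K) ≤ n := hn0.trans (by exact_mod_cast (by omega))
  have := hlt n
  nlinarith

/-- Chaining over unit steps. The scale `c` grows by at most `e^(1/4)` per step while the target
grows by `e^(1/2)`, so the step bounds form a geometric series of ratio `e^(-1/4)`, whence the
constant `C / (1 - e^(-1/4))`. -/
lemma exists_increment_bound_exp {g c : ℝ → ℝ} {C : ℝ} (hC : 0 ≤ C)
    (hc : ∀ᶠ s in atTop, 0 ≤ c s)
    (hq : ∀ᶠ s in atTop, c (s + 1) ≤ Real.exp (1 / 4) * c s)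
    (hloc : ∀ᶠ s in atTop, ∀ u ∈ Set.Icc (0 : ℝ) 1, |g (s + u) - g s| ≤ C * c s) :
    ∃ A : ℝ, 0 ≤ A ∧ ∀ᶠ s in atTop, ∀ u : ℝ, 0 ≤ u →
      |g (s + u) - g s| ≤ A * c s * Real.exp (u / 2) := by
  obtain ⟨s0, hs0⟩ := eventually_atTop.1 (hc.and (hq.and hloc))
  have he : 0 < 1 - Real.exp (-(1 / 4)) := by
    have : Real.exp (-(1/4)) < 1 := by rw [Real.exp_lt_one_iff]; norm_num
    linarith
  refine ⟨C / (1 - Real.exp (-(1 / 4))), by positivity, eventually_atTop.2 ⟨s0, ?_⟩⟩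
  set A := C / (1 - Real.exp (-(1 / 4))) with hA
  have hA0 : 0 ≤ A := by positivity
  have hAC : A * (1 - Real.exp (-(1 / 4))) = C := by rw [hA]; field_simp
  have hCA : C ≤ A := by nlinarith [Real.exp_pos (-(1/4))]
  have main : ∀ m : ℕ, ∀ s ≥ s0, ∀ u : ℝ, 0 ≤ u → u ≤ m + 1 →
      |g (s + u) - g s| ≤ A * c s * Real.exp (u / 2) := by
    intro m
    induction m with
    | zero =>
      intro s hs u hu hu1
      have h1 := (hs0 s hs).2.2 u ⟨hu, by simpa using hu1⟩
      have hcs := (hs0 s hs).1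
      have : 1 ≤ Real.exp (u / 2) := Real.one_le_exp (by positivity)
      calc _ ≤ C * c s := h1
        _ ≤ A * c s := by gcongr
        _ ≤ A * c s * Real.exp (u / 2) := le_mul_of_one_le_right (by positivity) this
    | succ m ih =>
      intro s hs u hu hu1
      by_cases hum : u ≤ m + 1
      · exact ih s hs u hu hum
      push Not at hum
      push_cast at hu1
      have hm0 : (0:ℝ) ≤ m := Nat.cast_nonneg m
      have h1 := (hs0 s hs).2.2 1 ⟨by norm_num, le_rfl⟩
      have h2 := ih (s + 1) (by linarith) (u - 1) (by linarith) (by linarith)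
      rw [show s + 1 + (u - 1) = s + u by ring] at h2
      have hcs := (hs0 s hs).1
      have hq' := (hs0 s hs).2.1
      have h3 := abs_sub_le (g (s + u)) (g (s + 1)) (g s)
      have h4 : A * c (s + 1) * Real.exp ((u - 1) / 2) ≤
          A * c s * (Real.exp (-(1 / 4)) * Real.exp (u / 2)) := by
        calc _ ≤ A * (Real.exp (1 / 4) * c s) * Real.exp ((u - 1) / 2) := by gcongr
          _ = A * c s * (Real.exp (1 / 4) * Real.exp ((u - 1) / 2)) := by ring
          _ = _ := by rw [← Real.exp_add, ← Real.exp_add]; ring_nf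
      have h5 : 1 ≤ Real.exp (u / 2) := Real.one_le_exp (by positivity)
      have h6 : C * c s ≤ A * c s * ((1 - Real.exp (-(1 / 4))) * Real.exp (u / 2)) := by
        calc C * c s ≤ C * c s * Real.exp (u / 2) :=
              le_mul_of_one_le_right (by positivity) h5
          _ = _ := by rw [← hAC]; ring
      nlinarith
  intro s hs u hu
  obtain ⟨m, hm⟩ := exists_nat_ge u
  exact main m s hs u hu (by linarith)

/-- Substitute `y = e^u x`. Through this identity the unit increments of `g` get the limiting ratio
`e^(ρ u)` under a shift by `u`. -/
lemma hRho_exp_add (ρ u : ℝ) :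
    hRho ρ (Real.exp (u + 1)) - hRho ρ (Real.exp u) =
      Real.exp (ρ * u) * hRho ρ (Real.exp 1) := by
  have hint : ∀ a b : ℝ, 0 < a → 0 < b →
      IntervalIntegrable (fun y : ℝ => y ^ (ρ - 1)) volume a b := by
    intro a b ha hb
    refine ContinuousOn.intervalIntegrable fun y hy => ?_
    have : 0 < y := lt_of_lt_of_le (lt_min ha hb) hy.1
    exact (Real.continuousAt_rpow_const y _ (Or.inl this.ne')).continuousWithinAt
  have h1 : hRho ρ (Real.exp (u + 1)) - hRho ρ (Real.exp u) =
      ∫ y in (Real.exp u)..(Real.exp (u + 1)), y ^ (ρ - 1) := by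
    unfold hRho
    rw [eq_comm, eq_sub_iff_add_eq', intervalIntegral.integral_add_adjacent_intervals] <;>
    exact hint _ _ (by positivity) (by positivity)
  rw [h1]
  have h2 := intervalIntegral.mul_integral_comp_mul_left (a := 1) (b := Real.exp 1)
    (f := fun y : ℝ => y ^ (ρ - 1)) (c := Real.exp u)
  rw [mul_one, ← Real.exp_add] at h2
  rw [← h2]
  have h3 : ∫ x in (1:ℝ)..Real.exp 1, (Real.exp u * x) ^ (ρ - 1) =
      ∫ x in (1:ℝ)..Real.exp 1, Real.exp (u * (ρ - 1)) * x ^ (ρ - 1) := by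
    refine intervalIntegral.integral_congr fun x hx => ?_
    have hx1 : 1 ≤ x := by
      rw [Set.uIcc_of_le (Real.one_le_exp (by norm_num))] at hx
      exact hx.1
    change (Real.exp u * x) ^ (ρ - 1) = _
    rw [Real.mul_rpow (by positivity) (by positivity), Real.exp_mul]
  rw [h3, intervalIntegral.integral_const_mul, ← mul_assoc, ← Real.exp_add]
  unfold hRho
  ring_nf

lemma hRho_exp_one_pos (ρ : ℝ) : 0 < hRho ρ (Real.exp 1) := by
  unfold hRho
  refine intervalIntegral.intervalIntegral_pos_of_pos_on ?_ ?_ (by simp)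
  · refine ContinuousOn.intervalIntegrable fun y hy => ?_
    have : 0 < y := lt_of_lt_of_le (lt_min one_pos (Real.exp_pos 1)) hy.1
    exact (Real.continuousAt_rpow_const y _ (Or.inl this.ne')).continuousWithinAt
  · intro x hx
    exact Real.rpow_pos_of_pos (one_pos.trans hx.1) _

/-- `B` need not be measurable, so it is replaced by `c s = |g (s + 1) - g s|`, which is measurable
and asymptotically proportional to `|B s|`. The pointwise-to-uniform argument is used twice: on `log
c`, to control the scale itself, then on `g`. Since `ρ ≤ 0`, the ratio `c (s + 1) / c s` tends to
`e^ρ < e^(1/4)`, as chaining requires. The shift by `log 2` will put the base point below the `k +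
1` largest observations. -/
theorem exists_increment_bound_of_secondOrder {g B : ℝ → ℝ} {ρ : ℝ} (hρ : ρ ≤ 0)
    (hg : Measurable g)
    (h : ∀ u : ℝ, 0 ≤ u →
      Tendsto (fun s => (g (s + u) - g s) / B s) atTop (𝓝 (hRho ρ (Real.exp u)))) :
    ∃ C : ℝ, 0 ≤ C ∧ ∀ᶠ s in atTop, ∀ u : ℝ, 0 ≤ u →
      |g (s - Real.log 2 + u) - g (s - Real.log 2)| ≤ C * |B s| * Real.exp (u / 2) := by
  have hh := hRho_exp_one_pos ρ
  set h1 := hRho ρ (Real.exp 1) with hh1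
  set c : ℝ → ℝ := fun s => |g (s + 1) - g s| with hcdef
  have hcB : Tendsto (fun s => (g (s + 1) - g s) / B s) atTop (𝓝 h1) := h 1 (by norm_num)
  have hBne : ∀ᶠ s in atTop, 0 < (g (s + 1) - g s) / B s := hcB.eventually (lt_mem_nhds hh)
  have hshift : ∀ u : ℝ, 0 ≤ u →
      Tendsto (fun s => c (s + u) / c s) atTop (𝓝 (Real.exp (ρ * u))) := by
    intro u hu
    have := (((h (u + 1) (by linarith)).sub (h u hu)).div hcB hh.ne').abs
    rw [hRho_exp_add, mul_div_cancel_right₀ _ hh.ne', abs_of_pos (Real.exp_pos _)] at this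
    refine this.congr' ?_
    filter_upwards [hBne] with s hs
    have hB0 : B s ≠ 0 := by rintro h0; rw [h0] at hs; simp at hs
    have hc0 : g (s + 1) - g s ≠ 0 := by rintro h0; rw [h0] at hs; simp at hs
    simp only [hcdef]
    rw [← abs_div]
    congr 1
    rw [Pi.div_apply, ← sub_div, div_div_div_cancel_right₀ hB0]
    ring_nf
  have hcpos : ∀ᶠ s in atTop, 0 < c s := by
    filter_upwards [hBne] with s hs
    exact abs_pos.2 (by rintro h0; rw [h0] at hs; simp at hs)
  -- the logarithm of the scale has locally bounded increments
  have hcm : Measurable c := by fun_prop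
  have hKex : ∃ K : ℝ, ∀ᶠ s in atTop, ∀ u ∈ Set.Icc (0 : ℝ) 1, c (s + u) ≤ K * c s := by
    obtain ⟨C, hC⟩ := exists_increment_bound_of_pointwise (g := fun s => Real.log (c s))
      (c := fun _ => 1) (K := 1) (by fun_prop) (by simp) (by simp) (by
        intro u hu
        refine ⟨|ρ * u| + 1, ?_⟩
        have hl := ((Real.continuousAt_log (Real.exp_pos (ρ * u)).ne').tendsto.comp
          (hshift u hu)).abs
        rw [Real.log_exp] at hl
        have hsu : Tendsto (fun s : ℝ => s + u) atTop atTop := tendsto_atTop_add_const_right _ _ tendsto_id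
        filter_upwards [hl.eventually (gt_mem_nhds (lt_add_one _)), hcpos,
          hsu.eventually hcpos] with s hs hs1 hs2
        rw [Function.comp_apply, Real.log_div hs2.ne' hs1.ne'] at hs
        linarith)
    obtain ⟨s0, hs0⟩ := eventually_atTop.1 hcpos
    refine ⟨Real.exp C, ?_⟩
    filter_upwards [hC, eventually_ge_atTop s0] with s hs hss u hu
    have h2 := (abs_le.1 (hs u hu)).2
    have p1 := hs0 s hss
    have p2 := hs0 (s + u) (by linarith [hu.1])
    rw [mul_one] at h2
    rw [← Real.log_le_log_iff p2 (by positivity), Real.log_mul (Real.exp_pos _).ne' p1.ne',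
      Real.log_exp]
    linarith
  obtain ⟨K, hK⟩ := hKex
  obtain ⟨C, hC⟩ := exists_increment_bound_of_pointwise hg
    (hcpos.mono fun s hs => hs.le) hK (by
      intro u hu
      refine ⟨|hRho ρ (Real.exp u) / h1| + 1, ?_⟩
      have := ((h u hu).div hcB hh.ne').abs
      filter_upwards [this.eventually_lt_const (lt_add_one _), hBne, hcpos] with s hs hs1 hs2
      have hB0 : B s ≠ 0 := by rintro h0; rw [h0] at hs1; simp at hs1
      rw [Pi.div_apply, div_div_div_cancel_right₀ hB0, abs_div, div_lt_iff₀ hs2] at hs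
      exact hs.le)
  obtain ⟨A, hA0, hA⟩ := exists_increment_bound_exp (le_max_right C 0)
    (hcpos.mono fun s hs => hs.le) (by
      have := (hshift 1 (by norm_num)).eventually_lt_const (u := Real.exp (1/4))
        (Real.exp_lt_exp.2 (by linarith))
      filter_upwards [this, hcpos] with s hs hs1
      exact ((div_lt_iff₀ hs1).1 hs).le) (by
      filter_upwards [hC, hcpos] with s hs hs1 u hu
      refine (hs u hu).trans ?_
      gcongr
      exact le_max_left _ _)
  have hlog2 : 0 ≤ Real.log 2 := Real.log_nonneg (by norm_num)
  have hback : Tendsto (fun s : ℝ => s - Real.log 2) atTop atTop :=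
    tendsto_atTop_add_const_right _ (-Real.log 2) tendsto_id
  have hE := Real.exp_pos (ρ * Real.log 2)
  -- The factor with `2` compares `c (s - log 2)` to `c s`, whose ratio eventually exceeds half its
  -- limit; `h1 + 1` compares `c s` to `|B s|`.
  refine ⟨A * (2 / Real.exp (ρ * Real.log 2)) * (h1 + 1), by positivity, ?_⟩
  filter_upwards [hback.eventually hA, hback.eventually hcpos,
    hback.eventually ((hshift _ hlog2).eventually (lt_mem_nhds (half_lt_self hE))),
    hcB.abs.eventually_lt_const (u := h1 + 1) (by rw [abs_of_pos hh]; linarith),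
    hBne] with s hs1 hs2 hs3 hs4 hs5 u hu
  refine (hs1 u hu).trans ?_
  have hB0 : B s ≠ 0 := by rintro h0; rw [h0] at hs5; simp at hs5
  rw [lt_div_iff₀ hs2, sub_add_cancel] at hs3
  rw [abs_div, div_lt_iff₀ (abs_pos.2 hB0)] at hs4
  have h7 : c (s - Real.log 2) ≤ 2 / Real.exp (ρ * Real.log 2) * ((h1 + 1) * |B s|) := by
    rw [div_mul_eq_mul_div, le_div_iff₀ hE]
    have : c s ≤ (h1 + 1) * |B s| := hs4.le
    nlinarith
  calc A * c (s - Real.log 2) * Real.exp (u / 2)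
      ≤ A * (2 / Real.exp (ρ * Real.log 2) * ((h1 + 1) * |B s|)) * Real.exp (u / 2) := by gcongr
    _ = _ := by ring

/-! ### Order statistics -/

lemma orderStat_eq_apply_sort {n : ℕ} (x : Fin n → ℝ) {m : ℕ} (h1 : 1 ≤ m) (h2 : m ≤ n) :
    orderStat x m = (x ∘ Tuple.sort x) ⟨m - 1, by omega⟩ := by
  unfold orderStat
  rw [dif_pos ⟨h1, h2⟩]
  rfl

lemma orderStat_le_orderStat {n : ℕ} (x : Fin n → ℝ) {m m' : ℕ} (h1 : 1 ≤ m) (h2 : m ≤ m')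
    (h3 : m' ≤ n) : orderStat x m ≤ orderStat x m' := by
  rw [orderStat_eq_apply_sort x h1 (h2.trans h3), orderStat_eq_apply_sort x (h1.trans h2) h3]
  refine Tuple.monotone_sort x ?_
  rw [Fin.mk_le_mk]
  omega

lemma orderStat_mem {n : ℕ} {x : Fin n → ℝ} {S : Set ℝ} (hx : ∀ i, x i ∈ S) {m : ℕ} (h1 : 1 ≤ m)
    (h2 : m ≤ n) : orderStat x m ∈ S := by
  rw [orderStat_eq_apply_sort x h1 h2]
  exact hx _

/-- Ties created by `φ` may change the sorting permutation, but the sorted vector is unique.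
Monotonicity is asked only on `S` because the tail quantile function is monotone only on `(1, ∞)`.
-/
lemma orderStat_comp_monotoneOn {n : ℕ} {x : Fin n → ℝ} {S : Set ℝ} {φ : ℝ → ℝ}
    (hφ : MonotoneOn φ S) (hx : ∀ i, x i ∈ S) {m : ℕ} (h1 : 1 ≤ m) (h2 : m ≤ n) :
    orderStat (fun i => φ (x i)) m = φ (orderStat x m) := by
  have hmono : Monotone ((fun i => φ (x i)) ∘ Tuple.sort x) := fun i j hij =>
    hφ (hx _) (hx _) (Tuple.monotone_sort x hij)
  rw [orderStat_eq_apply_sort _ h1 h2, orderStat_eq_apply_sort _ h1 h2,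
    ← Tuple.comp_sort_eq_comp_iff_monotone.2 hmono]
  rfl

lemma measurableSet_monotone_comp {n : ℕ} (σ : Fin n → Fin n) :
    MeasurableSet {x : Fin n → ℝ | Monotone (x ∘ σ)} := by
  have : {x : Fin n → ℝ | Monotone (x ∘ σ)} =
      ⋂ i, ⋂ j, {x : Fin n → ℝ | i ≤ j → x (σ i) ≤ x (σ j)} := by
    ext x
    simp only [Set.mem_ofPred_eq, Set.mem_iInter, Monotone, Function.comp_apply]
  rw [this]
  refine MeasurableSet.iInter fun i => MeasurableSet.iInter fun j => ?_
  by_cases hij : i ≤ j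
  · simp only [hij, true_implies]
    exact measurableSet_le (by fun_prop) (by fun_prop)
  · simp [hij]

/-- The sorting permutation depends on `x`, but it ranges over a finite set, and any permutation
that sorts `x` produces the same vector. -/
lemma measurable_comp_sort (n : ℕ) :
    Measurable (fun x : Fin n → ℝ => x ∘ Tuple.sort x) := by
  intro s hs
  have : (fun x : Fin n → ℝ => x ∘ Tuple.sort x) ⁻¹' s = ⋃ σ : Equiv.Perm (Fin n),
      {x : Fin n → ℝ | Monotone (x ∘ σ)} ∩ ((fun x : Fin n → ℝ => x ∘ σ) ⁻¹' s) := by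
    ext x
    simp only [Set.mem_preimage, Set.mem_iUnion, Set.mem_inter_iff, Set.mem_ofPred_eq]
    constructor
    · intro h
      exact ⟨Tuple.sort x, Tuple.monotone_sort x, h⟩
    · rintro ⟨σ, h1, h2⟩
      rwa [← Tuple.comp_sort_eq_comp_iff_monotone.2 h1]
  rw [this]
  refine MeasurableSet.iUnion fun σ => (measurableSet_monotone_comp σ).inter (hs.preimage ?_)
  exact measurable_pi_lambda _ fun i => measurable_pi_apply _

lemma measurable_orderStat (n m : ℕ) : Measurable (fun x : Fin n → ℝ => orderStat x m) := by
  by_cases h : 1 ≤ m ∧ m ≤ n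
  · simp only [fun x : Fin n → ℝ => orderStat_eq_apply_sort x h.1 h.2]
    exact (measurable_pi_apply _).comp (measurable_comp_sort n)
  · simp only [orderStat, dif_neg h, measurable_const]

lemma sum_orderStat_le {n k : ℕ} (hk : k ≤ n) (x : Fin n → ℝ) {ψ : ℝ → ℝ} (hψ : ∀ y, 0 ≤ ψ y) :
    ∑ j ∈ Finset.Icc 1 k, ψ (orderStat x (n - j + 1)) ≤ ∑ i, ψ (x i) := by
  rcases Nat.eq_zero_or_pos n with rfl | hn
  · obtain rfl : k = 0 := by omega
    simp
  -- The reduction mod `n` only makes `e` total; it does nothing for `1 ≤ j ≤ k`.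
  let e : ℕ → Fin n := fun j => Tuple.sort x ⟨(n - j) % n, Nat.mod_lt _ hn⟩
  have he : Set.InjOn e (Finset.Icc 1 k : Finset ℕ) := by
    intro i hi j hj hij
    simp only [Finset.coe_Icc, Set.mem_Icc] at hi hj
    have := Fin.mk.inj_iff.1 ((Tuple.sort x).injective hij)
    rw [Nat.mod_eq_of_lt (by omega), Nat.mod_eq_of_lt (by omega)] at this
    omega
  calc ∑ j ∈ Finset.Icc 1 k, ψ (orderStat x (n - j + 1))
      = ∑ j ∈ Finset.Icc 1 k, ψ (x (e j)) := by
        refine Finset.sum_congr rfl fun j hj => ?_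
        rw [Finset.mem_Icc] at hj
        rw [orderStat_eq_apply_sort x (by omega) (by omega)]
        simp only [e, Function.comp_apply]
        congr 4
        rw [Nat.mod_eq_of_lt (by omega)]
        omega
    _ = ∑ i ∈ (Finset.Icc 1 k).image e, ψ (x i) :=
        (Finset.sum_image (f := fun i => ψ (x i)) he).symm
    _ ≤ ∑ i, ψ (x i) :=
        Finset.sum_le_sum_of_subset_of_nonneg (Finset.subset_univ _) fun i _ _ => hψ _

/-- Otherwise every value at least `s` would sit in one of the `k` top positions of the sorted
vector. -/
lemma le_orderStat_of_card {n k : ℕ} (hk : k < n) (x : Fin n → ℝ) {s : ℝ}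
    (h : k < (Finset.univ.filter fun i => s ≤ x i).card) : s ≤ orderStat x (n - k) := by
  by_contra hlt
  push Not at hlt
  have hsub : Finset.univ.filter (fun i => s ≤ x i) ⊆
      (Finset.univ.filter fun i : Fin n => n - k ≤ i).map (Tuple.sort x).toEmbedding := by
    intro i hi
    obtain ⟨j, rfl⟩ := (Tuple.sort x).surjective i
    rw [Finset.mem_filter] at hi
    refine Finset.mem_map_of_mem (Tuple.sort x).toEmbedding ?_
    rw [Finset.mem_filter]
    refine ⟨Finset.mem_univ _, ?_⟩
    by_contra hj
    rw [orderStat_eq_apply_sort x (by omega) (by omega)] at hlt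
    have : (x ∘ Tuple.sort x) j ≤ (x ∘ Tuple.sort x) ⟨n - k - 1, by omega⟩ :=
      Tuple.monotone_sort x (by rw [Fin.le_def]; simp only; omega)
    exact absurd (hi.2.trans this) (not_le.2 hlt)
  have h1 := h.trans_le (Finset.card_le_card hsub)
  rw [Finset.card_map] at h1
  have h2 : (Finset.univ.filter fun i : Fin n => n - k ≤ i).card ≤ (Finset.Ico (n - k) n).card :=
    Finset.card_le_card_of_injOn Fin.val (fun i hi => by
      have := (Finset.mem_filter.1 hi).2
      simp only [Finset.coe_Ico, Set.mem_Ico]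
      exact ⟨this, i.2⟩) Fin.val_injective.injOn
  rw [Nat.card_Ico] at h2
  omega

lemma sum_Icc_mul_sub {k : ℕ} (a : ℕ → ℝ) :
    ∑ j ∈ Finset.Icc 1 k, (j : ℝ) * (a j - a (j + 1)) =
      ∑ j ∈ Finset.Icc 1 k, a j - k * a (k + 1) := by
  induction k with
  | zero => simp
  | succ k ih =>
    rw [Finset.sum_Icc_succ_top (by omega), ih, Finset.sum_Icc_succ_top (by omega)]
    push_cast
    ring

/-- Abel summation trades the weights `j` for increments from the common base point `orderStat x (n
- k)`. -/
lemma sum_mul_orderStat_sub {n k : ℕ} (hk : k < n) (x : Fin n → ℝ) (φ : ℝ → ℝ) :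
    ∑ j ∈ Finset.Icc 1 k, (j : ℝ) * (φ (orderStat x (n - j + 1)) - φ (orderStat x (n - j))) =
      ∑ j ∈ Finset.Icc 1 k, (φ (orderStat x (n - j + 1)) - φ (orderStat x (n - k))) := by
  have := sum_Icc_mul_sub (k := k) (fun j => φ (orderStat x (n - j + 1)))
  rw [Finset.sum_sub_distrib, Finset.sum_const, Nat.card_Icc, nsmul_eq_mul]
  simp only [Nat.add_sub_cancel]
  rw [show n - (k + 1) + 1 = n - k by omega] at this
  rw [← this]
  refine Finset.sum_congr rfl fun j hj => ?_
  rw [Finset.mem_Icc] at hj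
  rw [show n - (j + 1) + 1 = n - j by omega]

/-! ### Rényi's representation of exponential order statistics -/

lemma pi_withDensity_ofReal {ι : Type*} [Fintype ι] {f : ℝ → ℝ} (hf : Integrable f)
    (hf0 : ∀ x, 0 ≤ f x) :
    Measure.pi (fun _ : ι => volume.withDensity fun x => ENNReal.ofReal (f x)) =
      (volume : Measure (ι → ℝ)).withDensity fun x => ∏ i, ENNReal.ofReal (f (x i)) := by
  have : IsFiniteMeasure (volume.withDensity fun x => ENNReal.ofReal (f x)) :=
    isFiniteMeasure_withDensity_ofReal hf.2
  refine Measure.pi_eq fun s hs => ?_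
  rw [withDensity_apply _ (MeasurableSet.univ_pi hs), volume_pi, Measure.restrict_pi_pi]
  simp only [← ENNReal.ofReal_prod_of_nonneg (fun i _ => hf0 _)]
  rw [← ofReal_integral_eq_lintegral_ofReal
    (Integrable.fintype_prod fun i => hf.mono_measure Measure.restrict_le_self)
    (ae_of_all _ fun x => Finset.prod_nonneg fun i _ => hf0 _),
    integral_fintype_prod_eq_prod (f := fun _ => f),
    ENNReal.ofReal_prod_of_nonneg fun i _ => integral_nonneg fun x => hf0 _]
  refine Finset.prod_congr rfl fun i _ => ?_
  rw [withDensity_apply _ (hs i), ← ofReal_integral_eq_lintegral_ofReal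
    (hf.mono_measure Measure.restrict_le_self) (ae_of_all _ hf0)]

lemma integrable_exponentialPDFReal : Integrable (exponentialPDFReal 1) := by
  refine ⟨by fun_prop, ?_⟩
  rw [hasFiniteIntegral_iff_ofReal (ae_of_all _ fun x => exponentialPDFReal_nonneg one_pos x)]
  have := lintegral_exponentialPDF_eq_one one_pos
  simp only [exponentialPDF] at this
  rw [this]
  exact ENNReal.one_lt_top

lemma pi_expMeasure (n : ℕ) :
    Measure.pi (fun _ : Fin n => expMeasure 1) = (volume : Measure (Fin n → ℝ)).withDensity
      fun x => ∏ i, exponentialPDF 1 (x i) :=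
  pi_withDensity_ofReal integrable_exponentialPDFReal (exponentialPDFReal_nonneg one_pos)

lemma ae_injective_pi_volume (n : ℕ) :
    ∀ᵐ x : Fin n → ℝ, Function.Injective x := by
  have : ∀ i j : Fin n, i ≠ j → ∀ᵐ x : Fin n → ℝ, x i ≠ x j := by
    intro i j hij
    let S : Submodule ℝ (Fin n → ℝ) :=
      LinearMap.ker ((LinearMap.proj i : (Fin n → ℝ) →ₗ[ℝ] ℝ) - LinearMap.proj j)
    have hS : S ≠ ⊤ := by
      intro h
      have h1 : (Pi.single i 1 : Fin n → ℝ) ∈ S := h ▸ Submodule.mem_top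
      simp [S, LinearMap.mem_ker, hij.symm] at h1
    have := Measure.addHaar_submodule volume S hS
    rw [ae_iff]
    convert this using 2
    ext x
    simp [S, sub_eq_zero]
  simp only [Function.Injective]
  rw [ae_all_iff]
  intro i
  rw [ae_all_iff]
  intro j
  by_cases hij : i = j
  · simp [hij]
  · filter_upwards [this i j hij] with x hx h
    exact absurd h hx

lemma map_comp_perm_pi {n : ℕ} (ν : Measure ℝ) [SigmaFinite ν] (σ : Equiv.Perm (Fin n)) :
    (Measure.pi (fun _ : Fin n => ν)).map (fun x => x ∘ σ) = Measure.pi (fun _ => ν) := by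
  refine (Measure.pi_eq fun s hs => ?_).symm
  have hm : Measurable (fun x : Fin n → ℝ => x ∘ σ) :=
    measurable_pi_lambda _ fun i => measurable_pi_apply _
  rw [Measure.map_apply hm (MeasurableSet.univ_pi hs)]
  have : (fun x : Fin n → ℝ => x ∘ σ) ⁻¹' Set.univ.pi s = Set.univ.pi fun i => s (σ.symm i) := by
    ext x
    simp only [Set.mem_preimage, Set.mem_univ_pi, Function.comp_apply]
    constructor
    · intro h i
      simpa using h (σ.symm i)
    · intro h i
      simpa using h (σ i)
  rw [this, Measure.pi_pi]
  exact Equiv.prod_comp σ.symm fun i => ν (s i)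

lemma measurableSet_strictMono (n : ℕ) : MeasurableSet {x : Fin n → ℝ | StrictMono x} := by
  have : {x : Fin n → ℝ | StrictMono x} =
      ⋂ i, ⋂ j, {x : Fin n → ℝ | i < j → x i < x j} := by
    ext x
    simp only [Set.mem_ofPred_eq, Set.mem_iInter, StrictMono]
  rw [this]
  refine MeasurableSet.iInter fun i => MeasurableSet.iInter fun j => ?_
  by_cases hij : i < j
  · simp only [hij, true_implies]
    exact measurableSet_lt (by fun_prop) (by fun_prop)
  · simp [hij]

/-- Ties are null, so up to a null set the space splits into the `n!` permuted copies of the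
strictly increasing cone, and exchangeability gives each the same contribution. -/
lemma map_sort_pi_apply {n : ℕ} (ν : Measure ℝ) [SigmaFinite ν]  (hac : Measure.pi (fun _ : Fin n => ν) ≪ volume)
    {S : Set (Fin n → ℝ)} (hS : MeasurableSet S) :
    (Measure.pi (fun _ : Fin n => ν)).map (fun x => x ∘ Tuple.sort x) S =
      n.factorial * Measure.pi (fun _ : Fin n => ν) ({x | StrictMono x} ∩ S) := by
  have hMS : MeasurableSet ({x : Fin n → ℝ | StrictMono x} ∩ S) :=
    (measurableSet_strictMono n).inter hS
  have hσ : ∀ σ : Equiv.Perm (Fin n), Measurable (fun x : Fin n → ℝ => x ∘ σ) := fun σ =>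
    measurable_pi_lambda _ fun i => measurable_pi_apply _
  rw [Measure.map_apply (measurable_comp_sort n) hS]
  have h1 : (fun x : Fin n → ℝ => x ∘ Tuple.sort x) ⁻¹' S
      =ᵐ[Measure.pi (fun _ : Fin n => ν)] ⋃ σ : Equiv.Perm (Fin n),
        (fun x : Fin n → ℝ => x ∘ σ) ⁻¹' ({x | StrictMono x} ∩ S) := by
    filter_upwards [hac (ae_injective_pi_volume n)] with x hx
    refine propext ?_
    change x ∘ Tuple.sort x ∈ S ↔ x ∈ ⋃ σ : Equiv.Perm (Fin n), _
    simp only [Set.mem_iUnion, Set.mem_preimage, Set.mem_inter_iff, Set.mem_ofPred_eq]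
    constructor
    · intro h
      exact ⟨Tuple.sort x, (Tuple.monotone_sort x).strictMono_of_injective
        (hx.comp (Tuple.sort x).injective), h⟩
    · rintro ⟨σ, h1, h2⟩
      rwa [← Tuple.comp_sort_eq_comp_iff_monotone.2 h1.monotone]
  rw [measure_congr h1, measure_iUnion]
  · rw [tsum_fintype]
    have : ∀ σ : Equiv.Perm (Fin n), Measure.pi (fun _ : Fin n => ν)
        ((fun x : Fin n → ℝ => x ∘ σ) ⁻¹' ({x | StrictMono x} ∩ S)) =
        Measure.pi (fun _ : Fin n => ν) ({x | StrictMono x} ∩ S) := by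
      intro σ
      rw [← Measure.map_apply (hσ σ) hMS, map_comp_perm_pi]
    simp only [this, Finset.sum_const, nsmul_eq_mul, Finset.card_univ, Fintype.card_perm,
      Fintype.card_fin]
  · intro σ τ hne
    rw [Function.onFun, Set.disjoint_left]
    rintro x ⟨h1, -⟩ ⟨h2, -⟩
    have h1' : StrictMono (x ∘ σ) := h1
    have h2' : StrictMono (x ∘ τ) := h2
    have h3 := Tuple.unique_monotone h1'.monotone h2'.monotone
    refine hne (Equiv.ext fun i => ?_)
    have hinj : Function.Injective x := by
      have := h1'.injective.comp σ.symm.injective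
      simpa [Function.comp_assoc] using this
    exact hinj (congrFun h3 i)
  · exact fun σ => hMS.preimage (hσ σ)

/-- The matrix taking normalised spacings to the sorted sample. -/
noncomputable def spacingMatrix (n : ℕ) : Matrix (Fin n) (Fin n) ℝ :=
  Matrix.of fun i j => if j ≤ i then 1 / ((n : ℝ) - j) else 0

lemma spacingMatrix_mulVec {n : ℕ} (s : Fin n → ℝ) (i : Fin n) :
    (spacingMatrix n).mulVec s i = ∑ j ∈ Finset.Iic i, s j / ((n : ℝ) - j) := by
  rw [Matrix.mulVec, dotProduct]
  simp only [spacingMatrix, Matrix.of_apply, ite_mul, zero_mul]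
  rw [← Finset.sum_filter]
  refine Finset.sum_congr (by ext; simp) fun j _ => by ring

lemma cast_sub_pos {n : ℕ} (j : Fin n) : 0 < (n : ℝ) - j := by
  have : ((j : ℕ) : ℝ) < n := by exact_mod_cast j.2
  linarith

/-- The matrix is triangular with diagonal `1 / (n - j)`. The Jacobian cancels the number `n!` of
orderings. -/
lemma det_spacingMatrix (n : ℕ) : (spacingMatrix n).det = (n.factorial : ℝ)⁻¹ := by
  rw [Matrix.det_of_isLowerTriangular]
  · simp only [spacingMatrix, Matrix.of_apply, le_refl, if_true]
    rw [Fin.prod_univ_eq_prod_range (fun j => 1 / ((n : ℝ) - j)) n,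
      ← Finset.prod_range_reflect, ← Finset.prod_range_add_one_eq_factorial]
    push_cast
    rw [← Finset.prod_inv_distrib]
    refine Finset.prod_congr rfl fun j hj => ?_
    rw [Finset.mem_range] at hj
    rw [Nat.cast_sub (by omega), Nat.cast_sub (by omega)]
    push_cast
    ring
  · intro i j hij
    have : i < j := hij
    simp [spacingMatrix, this]

/-- Each `s j` occurs in `n - j` rows with coefficient `1 / (n - j)`. As the exponential density
depends only on the sum, the change of variables preserves it. -/
lemma sum_spacingMatrix_mulVec {n : ℕ} (s : Fin n → ℝ) :
    ∑ i, (spacingMatrix n).mulVec s i = ∑ j, s j := by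
  simp only [spacingMatrix_mulVec]
  have : ∀ i : Fin n, ∑ j ∈ Finset.Iic i, s j / ((n : ℝ) - j) =
      ∑ j, if j ≤ i then s j / ((n : ℝ) - j) else 0 := by
    intro i
    rw [← Finset.sum_filter]
    exact Finset.sum_congr (by ext; simp) fun _ _ => rfl
  simp only [this]
  rw [Finset.sum_comm]
  refine Finset.sum_congr rfl fun j _ => ?_
  rw [← Finset.sum_filter, Finset.sum_const, nsmul_eq_mul]
  have hc : (Finset.univ.filter fun i => j ≤ i) = Finset.Ici j := by ext; simp
  rw [hc, Fin.card_Ici, Nat.cast_sub j.2.le]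
  have := cast_sub_pos j
  field_simp

lemma spacingMatrix_mulVec_sub {n : ℕ} (s : Fin n → ℝ) {i : ℕ} (hi : i + 1 < n) :
    (spacingMatrix n).mulVec s ⟨i + 1, hi⟩ - (spacingMatrix n).mulVec s ⟨i, by omega⟩ =
      s ⟨i + 1, hi⟩ / ((n : ℝ) - (i + 1)) := by
  simp only [spacingMatrix_mulVec]
  have : Finset.Iic (⟨i + 1, hi⟩ : Fin n) = insert ⟨i + 1, hi⟩ (Finset.Iic ⟨i, by omega⟩) := by
    ext j
    simp only [Finset.mem_Iic, Finset.mem_insert, Fin.le_def, Fin.ext_iff]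
    omega
  rw [this, Finset.sum_insert (by simp [Fin.le_def])]
  push_cast
  ring

lemma prod_exponentialPDF_of_pos {n : ℕ} {x : Fin n → ℝ} (hx : ∀ i, 0 ≤ x i) :
    ∏ i, exponentialPDF 1 (x i) = ENNReal.ofReal (Real.exp (-∑ i, x i)) := by
  rw [← Finset.sum_neg_distrib, Real.exp_sum,
    ENNReal.ofReal_prod_of_nonneg fun i _ => (Real.exp_pos _).le]
  refine Finset.prod_congr rfl fun i _ => ?_
  rw [exponentialPDF_of_nonneg (hx i)]
  simp

/-- **Rényi's representation**: the sorted sample of `n` independent standard exponential variables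
is distributed as `(∑_{j ≤ i} s_j / (n - j))_i`, with `s` another such sample. -/
theorem map_sort_pi_expMeasure (n : ℕ) :
    (Measure.pi (fun _ : Fin n => expMeasure 1)).map (fun x => x ∘ Tuple.sort x) =
      (Measure.pi (fun _ : Fin n => expMeasure 1)).map (Matrix.toLin' (spacingMatrix n)) := by
  classical
  have := isProbabilityMeasure_expMeasure one_pos
  have hdens := pi_expMeasure n
  have hp : Measurable (fun x : Fin n → ℝ => ∏ i, exponentialPDF 1 (x i)) := by
    refine Finset.measurable_prod _ fun i _ => ?_
    exact ((measurable_exponentialPDFReal 1).ennreal_ofReal).comp (measurable_pi_apply i)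
  have hA : Measurable (Matrix.toLin' (spacingMatrix n)) :=
    (LinearMap.continuous_on_pi _).measurable
  have hdet : (spacingMatrix n).det ≠ 0 := by
    rw [det_spacingMatrix]
    positivity
  have hvol := Real.map_matrix_volume_pi_eq_smul_volume_pi hdet
  rw [det_spacingMatrix, inv_inv, abs_of_nonneg (by positivity), ENNReal.ofReal_natCast] at hvol
  ext S hS
  have hMS : MeasurableSet ({x : Fin n → ℝ | StrictMono x} ∩ S) :=
    (measurableSet_strictMono n).inter hS
  rw [map_sort_pi_apply _
    (hdens ▸ withDensity_absolutelyContinuous _ _) hS, Measure.map_apply hA hS, hdens,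
    withDensity_apply _ hMS, withDensity_apply _ (hS.preimage hA), ← lintegral_indicator hMS,
    ← lintegral_indicator (hS.preimage hA), ← smul_eq_mul, ← lintegral_smul_measure, ← hvol,
    lintegral_map (hp.indicator hMS) hA]
  -- The factor `n!` has been absorbed by pushing Lebesgue measure forward, so the two densities
  -- need only be compared at almost every `s`.
  refine lintegral_congr_ae ?_
  have hne : ∀ᵐ s : Fin n → ℝ, ∀ i, s i ≠ 0 := ae_all_iff.2 fun i => 
    Measure.ae_eval_ne (μ := fun _ : Fin n => (volume : Measure ℝ)) i 0
  filter_upwards [hne] with s hs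
  set y := Matrix.toLin' (spacingMatrix n) s with hy
  have hyv : ∀ i, y i = (spacingMatrix n).mulVec s i := fun i => by rw [hy, Matrix.toLin'_apply]
  by_cases hpos : ∀ i, 0 < s i
  · have hmono : StrictMono y := by
      intro i j hij
      rw [hyv, hyv, spacingMatrix_mulVec, spacingMatrix_mulVec]
      refine Finset.sum_lt_sum_of_subset (Finset.Iic_subset_Iic.2 hij.le) (i := j) (by simp)
        (by simpa using hij) (div_pos (hpos j) (cast_sub_pos j))
        fun l _ _ => (div_pos (hpos l) (cast_sub_pos l)).le
    have hy0 : ∀ i, 0 ≤ y i := by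
      intro i
      rw [hyv, spacingMatrix_mulVec]
      exact Finset.sum_nonneg fun l _ => (div_pos (hpos l) (cast_sub_pos l)).le
    have hpy : ∏ i, exponentialPDF 1 (y i) = ∏ i, exponentialPDF 1 (s i) := by
      rw [prod_exponentialPDF_of_pos hy0, prod_exponentialPDF_of_pos fun i => (hpos i).le]
      simp only [hyv, sum_spacingMatrix_mulVec]
    by_cases hyS : y ∈ S
    · rw [Set.indicator_of_mem (show y ∈ {x | StrictMono x} ∩ S from ⟨hmono, hyS⟩),
        Set.indicator_of_mem (show s ∈ Matrix.toLin' (spacingMatrix n) ⁻¹' S from hyS), hpy]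
    · rw [Set.indicator_of_notMem (fun h => hyS h.2),
        Set.indicator_of_notMem (show s ∉ Matrix.toLin' (spacingMatrix n) ⁻¹' S from hyS)]
  · push Not at hpos
    obtain ⟨i, hi⟩ := hpos
    have hi' : s i < 0 := lt_of_le_of_ne hi (hs i)
    have hr : ∏ i, exponentialPDF 1 (s i) = 0 :=
      Finset.prod_eq_zero (Finset.mem_univ i) (exponentialPDF_of_neg hi')
    have hr' : (((Matrix.toLin' (spacingMatrix n)) ⁻¹' S).indicator
        (fun x => ∏ i, exponentialPDF 1 (x i))) s = 0 := by
      rw [Set.indicator_apply, hr, ite_self]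
    rw [hr']
    obtain ⟨m, hm⟩ := i
    -- A negative `s i` kills the density on the right. On the left, either the smallest coordinate
    -- of `y` is negative, or `y` decreases somewhere and leaves the cone.
    rcases m with _ | m
    · have : y ⟨0, hm⟩ < 0 := by
        rw [hyv, spacingMatrix_mulVec]
        have h0 : Finset.Iic (⟨0, hm⟩ : Fin n) = {⟨0, hm⟩} := by
          ext j
          simp [Fin.le_def, Fin.ext_iff]
        rw [h0, Finset.sum_singleton]
        exact div_neg_of_neg_of_pos hi' (cast_sub_pos _)
      have hpy : ∏ i, exponentialPDF 1 (y i) = 0 :=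
        Finset.prod_eq_zero (Finset.mem_univ _) (exponentialPDF_of_neg this)
      rw [Set.indicator_apply, hpy, ite_self]
    · refine Set.indicator_of_notMem (fun h => ?_) _
      have h1 : y ⟨m, by omega⟩ < y ⟨m + 1, hm⟩ := h.1 (by simp [Fin.lt_def])
      have h2 := spacingMatrix_mulVec_sub s hm
      rw [← hyv, ← hyv] at h2
      have h3 := div_neg_of_neg_of_pos hi' (cast_sub_pos ⟨m + 1, hm⟩)
      push_cast at h3
      linarith

/-! ### Moments and tails of the standard exponential law -/

lemma expMeasure_one_eq : expMeasure 1 =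
    (volume.restrict (Set.Ioi (0 : ℝ))).withDensity fun x => ENNReal.ofReal (Real.exp (-x)) := by
  have h : (fun x => exponentialPDF 1 x) =
      (Set.Ici (0 : ℝ)).indicator fun x => ENNReal.ofReal (Real.exp (-x)) := by
    ext x
    by_cases hx : 0 ≤ x
    · rw [exponentialPDF_of_nonneg hx, Set.indicator_of_mem (Set.mem_Ici.2 hx)]
      simp
    · rw [exponentialPDF_of_neg (not_le.1 hx), Set.indicator_of_notMem (by simpa using hx)]
  change volume.withDensity (fun x => exponentialPDF 1 x) = _
  rw [h, withDensity_indicator measurableSet_Ici, restrict_Ioi_eq_restrict_Ici]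

lemma lintegral_expMeasure {f : ℝ → ENNReal} (hf : Measurable f) :
    ∫⁻ x, f x ∂expMeasure 1 =
      ∫⁻ x in Set.Ioi 0, ENNReal.ofReal (Real.exp (-x)) * f x := by
  rw [expMeasure_one_eq, lintegral_withDensity_eq_lintegral_mul _ (by fun_prop) hf]
  rfl

lemma integral_expMeasure (f : ℝ → ℝ) :
    ∫ x, f x ∂expMeasure 1 = ∫ x in Set.Ioi 0, Real.exp (-x) * f x := by
  rw [expMeasure_one_eq, integral_withDensity_eq_integral_toReal_smul (by fun_prop) (by simp)]
  simp [ENNReal.toReal_ofReal, (Real.exp_pos _).le]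

lemma integral_id_expMeasure : ∫ x, x ∂expMeasure 1 = 1 := by
  have h := Real.Gamma_eq_integral (s := 2) (by norm_num)
  have h2 : Real.Gamma 2 = 1 := by simp
  rw [integral_expMeasure, ← h2, h]
  refine setIntegral_congr_fun measurableSet_Ioi fun x _ => ?_
  norm_num

lemma integral_sq_expMeasure : ∫ x, x ^ 2 ∂expMeasure 1 = 2 := by
  have h := Real.Gamma_eq_integral (s := 3) (by norm_num)
  have h2 : Real.Gamma 3 = 2 := by
    rw [show (3 : ℝ) = (2 : ℕ) + 1 by norm_num, Real.Gamma_nat_eq_factorial]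
    norm_num
  rw [integral_expMeasure, ← h2, h]
  refine setIntegral_congr_fun measurableSet_Ioi fun x _ => ?_
  norm_num

lemma memLp_id_expMeasure : MemLp (fun x : ℝ => x) 2 (expMeasure 1) := by
  rw [memLp_two_iff_integrable_sq (by fun_prop)]
  refine Integrable.of_integral_ne_zero ?_
  rw [integral_sq_expMeasure]
  norm_num

lemma expMeasure_Ici {s : ℝ} (hs : 0 ≤ s) :
    expMeasure 1 (Set.Ici s) = ENNReal.ofReal (Real.exp (-s)) := by
  rw [← lintegral_indicator_one measurableSet_Ici,
    lintegral_expMeasure (measurable_one.indicator measurableSet_Ici)]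
  have : ∀ x, ENNReal.ofReal (Real.exp (-x)) * (Set.Ici s).indicator 1 x =
      (Set.Ici s).indicator (fun x => ENNReal.ofReal (Real.exp (-x))) x := by
    intro x
    by_cases hx : x ∈ Set.Ici s <;> simp [hx]
  simp only [this]
  rw [restrict_Ioi_eq_restrict_Ici, setLIntegral_indicator measurableSet_Ici,
    Set.inter_eq_left.2 (Set.Ici_subset_Ici.2 hs), ← restrict_Ioi_eq_restrict_Ici,
    ← ofReal_integral_eq_lintegral_ofReal (integrableOn_exp_neg_Ioi s)
      (ae_of_all _ fun x => (Real.exp_pos _).le), integral_exp_neg_Ioi]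

/-- The excess function `e^((y - s) / 2) 1{y ≥ s}`. -/
noncomputable def expExcess (s y : ℝ) : ℝ :=
  (Set.Ici s).indicator (fun y => Real.exp ((y - s) / 2)) y

lemma expExcess_nonneg (s y : ℝ) : 0 ≤ expExcess s y :=
  Set.indicator_nonneg (fun _ _ => (Real.exp_pos _).le) _

lemma measurable_expExcess (s : ℝ) : Measurable (expExcess s) :=
  Measurable.indicator (by fun_prop) measurableSet_Ici

/-- By lack of memory this is the tail `e^(-s)` times the mean `2` of `e^(Y/2)`; the growth rate
`1/2` stays below the decay rate `1`. -/
lemma lintegral_expExcess {s : ℝ} (hs : 0 ≤ s) :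
    ∫⁻ y, ENNReal.ofReal (expExcess s y) ∂expMeasure 1 = ENNReal.ofReal (2 * Real.exp (-s)) := by
  rw [lintegral_expMeasure (measurable_expExcess s).ennreal_ofReal]
  have : ∀ x, ENNReal.ofReal (Real.exp (-x)) * ENNReal.ofReal (expExcess s x) =
      (Set.Ici s).indicator (fun x => ENNReal.ofReal (Real.exp (-(1 / 2) * x)
        * Real.exp (-(s / 2)))) x := by
    intro x
    unfold expExcess
    by_cases hx : x ∈ Set.Ici s
    · rw [Set.indicator_of_mem hx, Set.indicator_of_mem hx,
        ← ENNReal.ofReal_mul (Real.exp_pos _).le, ← Real.exp_add, ← Real.exp_add]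
      ring_nf
    · rw [Set.indicator_of_notMem hx, Set.indicator_of_notMem hx]
      simp
  simp only [this]
  rw [restrict_Ioi_eq_restrict_Ici, setLIntegral_indicator measurableSet_Ici,
    Set.inter_eq_left.2 (Set.Ici_subset_Ici.2 hs), ← restrict_Ioi_eq_restrict_Ici,
    ← ofReal_integral_eq_lintegral_ofReal
      ((integrableOn_exp_mul_Ioi (by norm_num) s).mul_const _)
      (ae_of_all _ fun x => by positivity), integral_mul_const,
    integral_exp_mul_Ioi (by norm_num)]
  congr 1
  rw [show -s = -(1 / 2) * s + -(s / 2) by ring, Real.exp_add]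
  ring

/-! ### Exponential samples: exceedances, spacings, central limit theorem -/

section Sample

variable {Ω : Type*} [MeasurableSpace Ω] {P : Measure Ω} [IsProbabilityMeasure P]

/-- Chebyshev's inequality for sums of `n` independent identically distributed variables. -/
lemma measureReal_abs_sum_sub_ge_le {Y : ℕ → Ω → ℝ} (hYm : ∀ i, MemLp (Y i) 2 P)
    (hind : iIndepFun Y P) {m v : ℝ} (hm : ∀ i, P[Y i] = m) (hv : ∀ i, Var[Y i; P] ≤ v)
    (n : ℕ) {c : ℝ} (hc : 0 < c) :
    P.real {ω | c ≤ |∑ i ∈ Finset.range n, Y i ω - n * m|} ≤ n * v / c ^ 2 := by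
  have hS : MemLp (∑ i ∈ Finset.range n, Y i) 2 P := memLp_finsetSum' _ fun i _ => hYm i
  have h1 := meas_ge_le_variance_div_sq hS hc
  have hmean : P[∑ i ∈ Finset.range n, Y i] = n * m := by
    simp only [Finset.sum_apply]
    rw [integral_finsetSum _ fun i _ => (hYm i).integrable (by norm_num)]
    simp [hm]
  have hvar : Var[∑ i ∈ Finset.range n, Y i; P] ≤ n * v := by
    rw [IndepFun.variance_sum (fun i _ => hYm i) fun i _ j _ hij => hind.indepFun hij]
    calc _ ≤ ∑ _i ∈ Finset.range n, v := Finset.sum_le_sum fun i _ => hv i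
      _ = n * v := by simp
  rw [hmean] at h1
  simp only [Finset.sum_apply] at h1
  have h2 : 0 ≤ n * v / c ^ 2 :=
    div_nonneg ((variance_nonneg _ _).trans hvar) (by positivity)
  refine ENNReal.toReal_le_of_le_ofReal h2 (h1.trans ?_)
  gcongr

variable {E : ℕ → Ω → ℝ}

/-- The level `s` makes the expected number of exceedances `2 k`. An indicator has variance at most
its mean, so Chebyshev at distance `k` gives `2 k / k ^ 2`. -/
lemma measureReal_card_le (hEm : ∀ i, Measurable (E i)) (hE : ∀ i, P.map (E i) = expMeasure 1)
    (hind : iIndepFun E P) {n k : ℕ} (hk : 0 < k) {s : ℝ} (hs : 0 ≤ s)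
    (hns : n * Real.exp (-s) = 2 * k) :
    P.real {ω | (Finset.univ.filter fun i : Fin n => s ≤ E i ω).card ≤ k} ≤ 2 / k := by
  let Y : ℕ → Ω → ℝ := fun i ω => (Set.Ici s).indicator (fun _ => (1 : ℝ)) (E i ω)
  have hφ : Measurable ((Set.Ici s).indicator (fun _ => (1 : ℝ))) :=
    measurable_const.indicator measurableSet_Ici
  have hYm : ∀ i, Measurable (Y i) := fun i => hφ.comp (hEm i)
  have hYind : iIndepFun Y P := hind.comp (fun _ => (Set.Ici s).indicator (fun _ => (1 : ℝ)))
    fun _ => hφ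
  have hY01 : ∀ i ω, 0 ≤ Y i ω ∧ Y i ω ≤ 1 := by
    intro i ω
    simp only [Y, Set.indicator_apply]
    split_ifs <;> norm_num
  have hYL : ∀ i, MemLp (Y i) 2 P := fun i =>
    MemLp.of_bound (hYm i).aestronglyMeasurable 1 (ae_of_all _ fun ω => by
      rw [Real.norm_eq_abs, abs_of_nonneg (hY01 i ω).1]
      exact (hY01 i ω).2)
  have hmean : ∀ i, P[Y i] = Real.exp (-s) := by
    intro i
    have h1 : ∫ x, (Set.Ici s).indicator (fun _ => (1 : ℝ)) x ∂(P.map (E i)) = P[Y i] :=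
      integral_map (hEm i).aemeasurable hφ.aestronglyMeasurable
    rw [← h1, hE, integral_indicator_const _ measurableSet_Ici, Measure.real, expMeasure_Ici hs,
      ENNReal.toReal_ofReal (Real.exp_pos _).le, smul_eq_mul, mul_one]
  have hvar : ∀ i, Var[Y i; P] ≤ Real.exp (-s) := by
    intro i
    rw [variance_eq_sub (hYL i), ← hmean i]
    have h2 : Y i ^ 2 = Y i := by
      ext ω
      simp only [Pi.pow_apply, Y, Set.indicator_apply]
      split_ifs <;> norm_num
    rw [h2]
    nlinarith [sq_nonneg (P[Y i])]
  have hkpos : (0 : ℝ) < k := by exact_mod_cast hk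
  have := measureReal_abs_sum_sub_ge_le hYL hYind hmean hvar n hkpos
  rw [hns] at this
  calc _ ≤ _ := measureReal_mono ?_
    _ ≤ _ := this
    _ = 2 / k := by field_simp
  intro ω hω
  rw [Set.mem_ofPred_eq] at hω ⊢
  have hcard : ((Finset.univ.filter fun i : Fin n => s ≤ E i ω).card : ℝ) =
      ∑ i ∈ Finset.range n, Y i ω := by
    rw [Finset.card_filter, ← Fin.sum_univ_eq_sum_range (fun i => Y i ω) n]
    push_cast
    refine Finset.sum_congr rfl fun i _ => ?_
    simp [Y, Set.indicator_apply]
  rw [← hcard, abs_sub_comm]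
  have h3 : ((Finset.univ.filter fun i : Fin n => s ≤ E i ω).card : ℝ) ≤ k := by
    exact_mod_cast hω
  rw [abs_of_nonneg (by linarith)]
  linarith

/-- Markov's inequality: the sum has mean `n * 2 e^(-s) = 4 k`. -/
lemma measureReal_sum_expExcess_gt_le (hEm : ∀ i, Measurable (E i))
    (hE : ∀ i, P.map (E i) = expMeasure 1)
    {n k : ℕ} (hk : 0 < k) {s : ℝ} (hs : 0 ≤ s)
    (hns : n * Real.exp (-s) = 2 * k) {M : ℝ} (hM : 0 < M) :
    P.real {ω | M * k < ∑ i : Fin n, expExcess s (E i ω)} ≤ 4 / M := by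
  have hkpos : (0 : ℝ) < k := by exact_mod_cast hk
  have hlin : ∫⁻ ω, ENNReal.ofReal (∑ i : Fin n, expExcess s (E i ω)) ∂P =
      ENNReal.ofReal (4 * k) := by
    have h1 : ∀ ω, ENNReal.ofReal (∑ i : Fin n, expExcess s (E i ω)) =
        ∑ i : Fin n, ENNReal.ofReal (expExcess s (E i ω)) := fun ω =>
      ENNReal.ofReal_sum_of_nonneg fun i _ => expExcess_nonneg _ _
    simp only [h1]
    have hme : ∀ i : ℕ, Measurable fun ω => ENNReal.ofReal (expExcess s (E i ω)) := fun i =>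
      ((measurable_expExcess s).comp (hEm i)).ennreal_ofReal
    rw [lintegral_finsetSum _ fun (i : Fin n) _ => hme i]
    have h2 : ∀ i : ℕ, ∫⁻ ω, ENNReal.ofReal (expExcess s (E i ω)) ∂P =
        ENNReal.ofReal (2 * Real.exp (-s)) := by
      intro i
      rw [← lintegral_expExcess hs, ← hE i,
        lintegral_map (measurable_expExcess s).ennreal_ofReal (hEm i)]
    simp only [h2, Finset.sum_const, Finset.card_univ, Fintype.card_fin, nsmul_eq_mul]
    rw [← ENNReal.ofReal_natCast, ← ENNReal.ofReal_mul (by positivity)]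
    congr 1
    linarith
  have hmeas : Measurable fun ω => ENNReal.ofReal (∑ i : Fin n, expExcess s (E i ω)) :=
    (Finset.measurable_fun_sum _ fun (i : Fin n) _ =>
      (measurable_expExcess s).comp (hEm i)).ennreal_ofReal
  have hmk := meas_ge_le_lintegral_div (μ := P) hmeas.aemeasurable
    (ε := ENNReal.ofReal (M * k)) (by simp; positivity) ENNReal.ofReal_ne_top
  rw [hlin, ← ENNReal.ofReal_div_of_pos (by positivity)] at hmk
  refine ENNReal.toReal_le_of_le_ofReal (by positivity) ?_
  calc _ ≤ _ := measure_mono ?_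
    _ ≤ _ := hmk
    _ = _ := by congr 1; field_simp
  intro ω hω
  exact ENNReal.ofReal_le_ofReal (le_of_lt hω)

/-- The first `n` terms of an independent identically distributed sequence, in any order. -/
lemma map_comp_eq_pi {ν : Measure ℝ} (hEm : ∀ i, Measurable (E i)) (hE : ∀ i, P.map (E i) = ν)
    (hind : iIndepFun E P) {n : ℕ} {e : Fin n → ℕ} (he : Function.Injective e) :
    P.map (fun ω i => E (e i) ω) = Measure.pi (fun _ : Fin n => ν) := by
  rw [(iIndepFun_iff_map_fun_eq_pi_map fun i => (hEm (e i)).aemeasurable).1 (hind.precomp he)]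
  simp only [hE]

/-- The sum `∑_{j ≤ k} j (x_(n-j+1) - x_(n-j))` of the upper normalised spacings. -/
noncomputable def spacingSum {n : ℕ} (x : Fin n → ℝ) (k : ℕ) : ℝ :=
  ∑ j ∈ Finset.Icc 1 k, (j : ℝ) * (orderStat x (n - j + 1) - orderStat x (n - j))

lemma measurable_spacingSum (n k : ℕ) : Measurable (fun x : Fin n → ℝ => spacingSum x k) :=
  Finset.measurable_fun_sum _ fun _ _ =>
    ((measurable_orderStat n _).sub (measurable_orderStat n _)).const_mul _

lemma map_spacingSum (hEm : ∀ i, Measurable (E i)) (hE : ∀ i, P.map (E i) = expMeasure 1)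
    (hind : iIndepFun E P) {n k : ℕ} (hk : k < n) :
    P.map (fun ω => spacingSum (fun i : Fin n => E i ω) k) =
      P.map (fun ω => ∑ j ∈ Finset.range k, E j ω) := by
  let G : (Fin n → ℝ) → ℝ := fun y => ∑ j : Fin k,
    ((j : ℝ) + 1) * (y ⟨n - (j + 1), by omega⟩ - y ⟨n - (j + 1) - 1, by omega⟩)
  have hG : Measurable G := by fun_prop
  have h1 : ∀ x : Fin n → ℝ, spacingSum x k = G (x ∘ Tuple.sort x) := by
    intro x
    simp only [spacingSum, G]
    have hr := Finset.sum_bij (s := (Finset.univ : Finset (Fin k))) (t := Finset.Icc 1 k)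
      (f := fun j => ((j : ℝ) + 1) * ((x ∘ Tuple.sort x) ⟨n - (j + 1), by omega⟩ -
        (x ∘ Tuple.sort x) ⟨n - (j + 1) - 1, by omega⟩))
      (g := fun j => (j : ℝ) * (orderStat x (n - j + 1) - orderStat x (n - j)))
      (fun j _ => (j : ℕ) + 1) (fun j _ => by simp)
      (fun i _ j _ h => by ext; simpa using h)
      (fun j hj => by
        rw [Finset.mem_Icc] at hj
        exact ⟨⟨j - 1, by omega⟩, Finset.mem_univ _, by simp only; omega⟩)
      (fun j _ => by
        rw [orderStat_eq_apply_sort x (by omega) (by omega),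
          orderStat_eq_apply_sort x (by omega) (by omega)]
        push_cast
        rfl)
    exact hr.symm
  have h2 : ∀ s : Fin n → ℝ, G (Matrix.toLin' (spacingMatrix n) s) =
      ∑ j : Fin k, s ⟨n - (j + 1), by omega⟩ := by
    intro s
    simp only [G]
    refine Finset.sum_congr rfl fun j _ => ?_
    have h3 := spacingMatrix_mulVec_sub s (i := n - (j + 1) - 1) (by omega)
    have h4 : (⟨n - (j + 1) - 1 + 1, by omega⟩ : Fin n) = ⟨n - (j + 1), by omega⟩ := by
      ext
      simp only
      omega
    rw [h4] at h3
    rw [Matrix.toLin'_apply, h3]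
    have h5 : (n : ℝ) - (((n - (j + 1) - 1 : ℕ) : ℝ) + 1) = j + 1 := by
      rw [Nat.cast_sub (by omega), Nat.cast_sub (by omega)]
      push_cast
      ring
    rw [h5]
    field_simp
  have hA : Measurable (Matrix.toLin' (spacingMatrix n)) :=
    (LinearMap.continuous_on_pi _).measurable
  have hvec : Measurable (fun ω (i : Fin n) => E i ω) := measurable_pi_lambda _ fun i => hEm i
  have hrev : Measurable (fun ω (i : Fin n) => E (n - 1 - i) ω) :=
    measurable_pi_lambda _ fun i => hEm _
  have hsum : Measurable (fun s : Fin n → ℝ => ∑ j : Fin k, s ⟨n - (j + 1), by omega⟩) := by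
    fun_prop
  calc P.map (fun ω => spacingSum (fun i : Fin n => E i ω) k)
      = ((P.map (fun ω (i : Fin n) => E i ω)).map (fun x => x ∘ Tuple.sort x)).map G := by
        rw [Measure.map_map hG (measurable_comp_sort n),
          Measure.map_map (hG.comp (measurable_comp_sort n)) hvec]
        congr 1
        ext ω
        exact h1 _
    -- In Rényi's representation the upper spacings are the last `k` coordinates; reversing the
    -- sample turns their sum into one over the first `k` variables.
    _ = ((P.map (fun ω (i : Fin n) => E (n - 1 - i) ω)).map
          (Matrix.toLin' (spacingMatrix n))).map G := by
        rw [map_comp_eq_pi hEm hE hind Fin.val_injective,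
          map_comp_eq_pi (e := fun i : Fin n => n - 1 - i) hEm hE hind
            (fun i j h => by ext; simp only at h; omega), map_sort_pi_expMeasure]
    _ = P.map (fun ω => ∑ j ∈ Finset.range k, E j ω) := by
        rw [Measure.map_map hG hA, Measure.map_map (hG.comp hA) hrev]
        congr 1
        ext ω
        simp only [Function.comp_apply, h2]
        rw [← Fin.sum_univ_eq_sum_range (fun j => E j ω) k]
        refine Finset.sum_congr rfl fun j _ => ?_
        congr 1
        omega

lemma memLp_two_of_map_eq_expMeasure {Y : Ω → ℝ} (hYm : Measurable Y)
    (hY : P.map Y = expMeasure 1) : MemLp Y 2 P := by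
  have hL := memLp_id_expMeasure
  rw [← hY] at hL
  exact (memLp_map_measure_iff measurable_id.aestronglyMeasurable hYm.aemeasurable).1 hL

lemma integral_of_map_eq_expMeasure {Y : Ω → ℝ} (hYm : Measurable Y)
    (hY : P.map Y = expMeasure 1) : P[Y] = 1 := by
  rw [← integral_id_expMeasure, ← hY]
  exact (integral_map hYm.aemeasurable measurable_id.aestronglyMeasurable).symm

lemma variance_of_map_eq_expMeasure {Y : Ω → ℝ} (hYm : Measurable Y)
    (hY : P.map Y = expMeasure 1) : Var[Y; P] = 1 := by
  have hsq : P[Y ^ 2] = 2 := by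
    rw [← integral_sq_expMeasure, ← hY]
    exact (integral_map hYm.aemeasurable (measurable_id.pow_const 2).aestronglyMeasurable).symm
  rw [variance_eq_sub (memLp_two_of_map_eq_expMeasure hYm hY),
    integral_of_map_eq_expMeasure hYm hY, hsq]
  norm_num

lemma tendstoInDistribution_sum_exp (hEm : ∀ i, Measurable (E i))
    (hE : ∀ i, P.map (E i) = expMeasure 1) (hind : iIndepFun E P) :
    TendstoInDistribution (fun (n : ℕ) ω => (√n)⁻¹ * (∑ j ∈ Finset.range n, E j ω - n)) atTop
      (id : ℝ → ℝ) (fun _ => P) (gaussianReal 0 1) := by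
  have hY : HasLaw (id : ℝ → ℝ) (gaussianReal 0 Var[E 0; P].toNNReal) (gaussianReal 0 1) := by
    rw [variance_of_map_eq_expMeasure (hEm 0) (hE 0), Real.toNNReal_one]
    exact HasLaw.id
  have := tendstoInDistribution_inv_sqrt_mul_sum_sub hY
    (memLp_two_of_map_eq_expMeasure (hEm 0) (hE 0)) hind
    (fun i => ⟨(hEm i).aemeasurable, (hEm 0).aemeasurable, by rw [hE, hE]⟩)
  simpa only [integral_of_map_eq_expMeasure (hEm 0) (hE 0), mul_one] using this

lemma measureReal_abs_sum_exp_sub_ge_le (hEm : ∀ i, Measurable (E i))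
    (hE : ∀ i, P.map (E i) = expMeasure 1) (hind : iIndepFun E P) (n : ℕ) {c : ℝ} (hc : 0 < c) :
    P.real {ω | c ≤ |∑ i ∈ Finset.range n, E i ω - n|} ≤ n / c ^ 2 := by
  simpa using measureReal_abs_sum_sub_ge_le
    (fun i => memLp_two_of_map_eq_expMeasure (hEm i) (hE i)) hind
    (fun i => integral_of_map_eq_expMeasure (hEm i) (hE i))
    (fun i => (variance_of_map_eq_expMeasure (hEm i) (hE i)).le) n hc

end Sample

/-! ### The quantile transform -/

section Quantile

variable (μ : Measure ℝ)

/-- Right-continuity of the distribution function makes the infimum attained; `x > 1` makes the set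
bounded below, and its level below `1` makes it nonempty. -/
lemma tailQuantile_le_iff {x : ℝ} (hx : 1 < x) (y : ℝ) :
    tailQuantile μ x ≤ y ↔ 1 - 1 / x ≤ cdf μ y := by
  have hp0 : 0 < 1 - 1 / x := by
    rw [sub_pos, div_lt_one (by linarith)]
    exact hx
  have hp1 : 1 - 1 / x < 1 := by
    have : 0 < 1 / x := by positivity
    linarith
  have hbdd : BddBelow {y : ℝ | 1 - 1 / x ≤ cdf μ y} := by
    obtain ⟨z, hz⟩ := ((tendsto_cdf_atBot μ).eventually_lt_const hp0).exists
    refine ⟨z, fun w hw => ?_⟩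
    by_contra hlt
    exact absurd ((hw : _ ≤ _).trans (monotone_cdf μ (not_le.1 hlt).le)) (not_le.2 hz)
  have hne : {y : ℝ | 1 - 1 / x ≤ cdf μ y}.Nonempty := by
    obtain ⟨z, hz⟩ := ((tendsto_cdf_atTop μ).eventually_const_lt hp1).exists
    exact ⟨z, hz.le⟩
  constructor
  · intro h
    have hr : 1 - 1 / x ≤ cdf μ (tailQuantile μ x) := by
      have hc := ((cdf μ).right_continuous (tailQuantile μ x)).mono_left
        (nhdsWithin_mono _ Set.Ioi_subset_Ici_self)
      refine ge_of_tendsto hc ?_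
      filter_upwards [self_mem_nhdsWithin] with z hz
      obtain ⟨w, hw, hwz⟩ := (csInf_lt_iff hbdd hne).1 (show tailQuantile μ x < z from hz)
      exact (hw : _ ≤ _).trans (monotone_cdf μ hwz.le)
    exact hr.trans (monotone_cdf μ h)
  · intro h
    exact csInf_le hbdd h

lemma monotoneOn_tailQuantile : MonotoneOn (tailQuantile μ) (Set.Ioi 1) := by
  intro x hx y hy hxy
  rw [tailQuantile_le_iff μ hx]
  have h1 := (tailQuantile_le_iff μ hy (tailQuantile μ y)).1 le_rfl
  have h2 : 1 / y ≤ 1 / x := one_div_le_one_div_of_le (by linarith [Set.mem_Ioi.1 hx]) hxy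
  linarith

lemma monotoneOn_tailQuantile_exp :
    MonotoneOn (fun y => tailQuantile μ (Real.exp y)) (Set.Ioi 0) := fun _ hx _ hy hxy =>
  monotoneOn_tailQuantile μ (Real.one_lt_exp_iff.2 hx) (Real.one_lt_exp_iff.2 hy)
    (Real.exp_le_exp.2 hxy)

lemma tailQuantile_of_le_one {x : ℝ} (h0 : 0 < x) (hx : x ≤ 1) : tailQuantile μ x = 0 := by
  unfold tailQuantile
  have : {y : ℝ | 1 - 1 / x ≤ cdf μ y} = Set.univ := by
    refine Set.eq_univ_of_forall fun y => ?_
    have h1 : 1 ≤ 1 / x := by rwa [le_div_iff₀ h0, one_mul]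
    have := cdf_nonneg μ y
    change 1 - 1 / x ≤ cdf μ y
    linarith
  rw [this, Real.sInf_univ]

lemma measurable_tailQuantile_exp : Measurable fun y => tailQuantile μ (Real.exp y) := by
  refine measurable_of_Iic fun c => ?_
  have : (fun y => tailQuantile μ (Real.exp y)) ⁻¹' Set.Iic c =
      (Set.Ioi 0 ∩ {y | 1 - 1 / Real.exp y ≤ cdf μ c}) ∪ (Set.Iic 0 ∩ {_y | 0 ≤ c}) := by
    ext y
    by_cases hy : 0 < y
    · simp [hy, hy.not_ge, tailQuantile_le_iff μ (Real.one_lt_exp_iff.2 hy)]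
    · simp [hy, not_lt.1 hy, tailQuantile_of_le_one μ (Real.exp_pos y)
        (Real.exp_le_one_iff.2 (not_lt.1 hy))]
  rw [this]
  refine (measurableSet_Ioi.inter (measurableSet_le (by fun_prop) measurable_const)).union
    (measurableSet_Iic.inter (MeasurableSet.const _))

lemma ae_pos_expMeasure : ∀ᵐ y ∂expMeasure 1, 0 < y := by
  rw [expMeasure_one_eq]
  exact (withDensity_absolutelyContinuous _ _) (ae_restrict_mem measurableSet_Ioi)

/-- The quantile transform of a standard exponential variable. -/
lemma map_tailQuantile_exp [IsProbabilityMeasure μ] :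
    (expMeasure 1).map (fun y => tailQuantile μ (Real.exp y)) = μ := by
  have := isProbabilityMeasure_expMeasure one_pos
  have := Measure.isProbabilityMeasure_map (μ := expMeasure 1)
    (measurable_tailQuantile_exp μ).aemeasurable
  refine Measure.ext_of_Iic _ _ fun c => ?_
  rw [Measure.map_apply (measurable_tailQuantile_exp μ) measurableSet_Iic, ← ofReal_cdf μ c]
  have h0 := cdf_nonneg μ c
  have hset : (fun y => tailQuantile μ (Real.exp y)) ⁻¹' Set.Iic c =ᵐ[expMeasure 1]
      {y | 1 - cdf μ c ≤ Real.exp (-y)} := by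
    filter_upwards [ae_pos_expMeasure] with y hy
    refine propext ?_
    change tailQuantile μ (Real.exp y) ≤ c ↔ 1 - cdf μ c ≤ Real.exp (-y)
    rw [tailQuantile_le_iff μ (Real.one_lt_exp_iff.2 hy), Real.exp_neg, one_div]
    constructor <;> intro h <;> linarith
  rw [measure_congr hset]
  -- When the distribution function reaches `1` at `c`, the bound `-log (1 - F(c))` is infinite,
  -- whereas the real logarithm would return `0`.
  rcases (cdf_le_one μ c).eq_or_lt with h1 | h1
  · rw [h1]
    have : {y : ℝ | 1 - 1 ≤ Real.exp (-y)} = Set.univ :=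
      Set.eq_univ_of_forall fun y => by
        change 1 - 1 ≤ Real.exp (-y)
        rw [sub_self]
        exact (Real.exp_pos _).le
    rw [this]
    simp
  · have hpos : 0 < 1 - cdf μ c := by linarith
    have : {y : ℝ | 1 - cdf μ c ≤ Real.exp (-y)} = Set.Iic (-Real.log (1 - cdf μ c)) := by
      ext y
      change 1 - cdf μ c ≤ Real.exp (-y) ↔ y ≤ _
      rw [← Real.log_le_iff_le_exp hpos, le_neg]
    rw [this, ← ofReal_cdf (expMeasure 1), cdf_expMeasure_eq one_pos, if_pos, one_mul, neg_neg,
      Real.exp_log hpos, sub_sub_cancel]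
    rw [Left.nonneg_neg_iff]
    exact Real.log_nonpos hpos.le (by linarith)

end Quantile

/-! ### The Hill sum compared with the exponential spacing sum -/

/-- The logarithm of the slowly varying part of the tail quantile function, in the exponential
scale. -/
noncomputable def logSlowPart (μ : Measure ℝ) (γ s : ℝ) : ℝ :=
  Real.log (tailQuantile μ (Real.exp (max s 1))) - γ * s

lemma measurable_logSlowPart (μ : Measure ℝ) (γ : ℝ) : Measurable (logSlowPart μ γ) := by
  have : Measurable fun s : ℝ => tailQuantile μ (Real.exp (max s 1)) :=
    (measurable_tailQuantile_exp μ).comp (by fun_prop : Measurable fun s : ℝ => max s 1)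
  exact this.log.sub (by fun_prop)

lemma exists_logSlowPart_bound {μ : Measure ℝ} {γ : ℝ} {ℓ b : ℝ → ℝ} {ρ : ℝ}
    (hU : ∀ᶠ x in atTop, tailQuantile μ x = x ^ γ * ℓ x) (hℓ : ∀ᶠ x in atTop, 0 < ℓ x)
    (hb : SecondOrderCondition ℓ b ρ) :
    ∃ C : ℝ, 0 ≤ C ∧ ∀ᶠ s in atTop, ∀ u : ℝ, 0 ≤ u →
      |logSlowPart μ γ (s - Real.log 2 + u) - logSlowPart μ γ (s - Real.log 2)| ≤
        C * |b (Real.exp s)| * Real.exp (u / 2) := by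
  refine exists_increment_bound_of_secondOrder (B := fun s => b (Real.exp s)) hb.1
    (measurable_logSlowPart μ γ) fun u hu => ?_
  have hlog : ∀ᶠ s in atTop, 0 < ℓ (Real.exp s) ∧
      logSlowPart μ γ s = Real.log (ℓ (Real.exp s)) := by
    filter_upwards [Real.tendsto_exp_atTop.eventually hU, Real.tendsto_exp_atTop.eventually hℓ,
      eventually_ge_atTop 1] with s h1 h2 h3
    refine ⟨h2, ?_⟩
    rw [logSlowPart, max_eq_left h3, h1, ← Real.exp_mul,
      Real.log_mul (Real.exp_pos _).ne' h2.ne', Real.log_exp]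
    ring
  have hsu : Tendsto (fun s : ℝ => s + u) atTop atTop :=
    tendsto_atTop_add_const_right _ _ tendsto_id
  refine ((hb.2.2 (Real.exp u) (Real.one_le_exp hu)).comp Real.tendsto_exp_atTop).congr' ?_
  filter_upwards [hlog, hsu.eventually hlog] with s h1 h2
  rw [Function.comp_apply, h1.2, h2.2, ← Real.exp_add, Real.log_div h2.1.ne' h1.1.ne']

lemma eventually_tailQuantile_exp_pos {μ : Measure ℝ} {γ : ℝ} {ℓ : ℝ → ℝ}
    (hU : ∀ᶠ x in atTop, tailQuantile μ x = x ^ γ * ℓ x) (hℓ : ∀ᶠ x in atTop, 0 < ℓ x) :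
    ∀ᶠ s in atTop, 0 < tailQuantile μ (Real.exp s) := by
  filter_upwards [Real.tendsto_exp_atTop.eventually hU, Real.tendsto_exp_atTop.eventually hℓ]
    with s h1 h2
  rw [h1]
  positivity

/-- The sum `∑_{j ≤ k} T_j`, which is `k` times the Hill estimator. -/
noncomputable def hillSum {n : ℕ} (x : Fin n → ℝ) (k : ℕ) : ℝ :=
  ∑ j ∈ Finset.Icc 1 k, logSpacing x j

lemma measurable_logSpacing (n j : ℕ) : Measurable (fun x : Fin n → ℝ => logSpacing x j) :=
  ((measurable_orderStat n _).log.sub (measurable_orderStat n _).log).const_mul _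

lemma measurable_hillSum (n k : ℕ) : Measurable (fun x : Fin n → ℝ => hillSum x k) :=
  Finset.measurable_fun_sum _ fun j _ => measurable_logSpacing n j

section Deterministic

variable {μ : Measure ℝ} {n k : ℕ} {x : Fin n → ℝ} {s : ℝ}

lemma logSpacing_tailQuantile_exp (hk : k < n) (hx : ∀ i, x i ∈ Set.Ioi (0 : ℝ)) {j : ℕ}
    (hj : j ∈ Finset.Icc 1 k) :
    logSpacing (fun i => tailQuantile μ (Real.exp (x i))) j =
      j * (Real.log (tailQuantile μ (Real.exp (orderStat x (n - j + 1)))) -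
        Real.log (tailQuantile μ (Real.exp (orderStat x (n - j))))) := by
  rw [Finset.mem_Icc] at hj
  rw [logSpacing, orderStat_comp_monotoneOn (monotoneOn_tailQuantile_exp μ) hx (by omega) (by omega),
    orderStat_comp_monotoneOn (monotoneOn_tailQuantile_exp μ) hx (by omega) (by omega)]

lemma logSpacing_tailQuantile_exp_nonneg (hk : k < n) (hx : ∀ i, x i ∈ Set.Ioi (0 : ℝ))
    (hs : s ≤ orderStat x (n - k)) (hpos : ∀ y, s ≤ y → 0 < tailQuantile μ (Real.exp y)) {j : ℕ}
    (hj : j ∈ Finset.Icc 1 k) :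
    0 ≤ logSpacing (fun i => tailQuantile μ (Real.exp (x i))) j := by
  rw [logSpacing_tailQuantile_exp hk hx hj]
  rw [Finset.mem_Icc] at hj
  refine mul_nonneg (Nat.cast_nonneg j) (sub_nonneg.2 (Real.log_le_log (hpos _ ?_) ?_))
  · exact hs.trans (orderStat_le_orderStat x (by omega) (by omega) (by omega))
  · exact monotoneOn_tailQuantile_exp μ (orderStat_mem hx (by omega) (by omega))
      (orderStat_mem hx (by omega) (by omega))
      (orderStat_le_orderStat x (by omega) (by omega) (by omega))

/-- After Abel summation each term is an increment of `logSlowPart` between two points above `s`.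
Passing through `s` costs two bounds, both dominated by the excess at the larger point; hence the
factor `2`. -/
lemma abs_hillSum_sub_le {γ A : ℝ} (hA : 0 ≤ A) (hk : k < n) (hx : ∀ i, x i ∈ Set.Ioi (0 : ℝ))
    (hs1 : 1 ≤ s) (hs : s ≤ orderStat x (n - k))
    (hbd : ∀ u : ℝ, 0 ≤ u →
      |logSlowPart μ γ (s + u) - logSlowPart μ γ s| ≤ A * Real.exp (u / 2)) :
    |hillSum (fun i => tailQuantile μ (Real.exp (x i))) k - γ * spacingSum x k| ≤
      2 * A * ∑ i, expExcess s (x i) := by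
  have hbd' : ∀ y, s ≤ y → |logSlowPart μ γ y - logSlowPart μ γ s| ≤ A * expExcess s y := by
    intro y hy
    have := hbd (y - s) (by linarith)
    rwa [add_sub_cancel, show Real.exp ((y - s) / 2) = expExcess s y by
      rw [expExcess, Set.indicator_of_mem (Set.mem_Ici.2 hy)]] at this
  have hexc : ∀ y z, s ≤ y → y ≤ z → expExcess s y ≤ expExcess s z := by
    intro y z hy hyz
    rw [expExcess, expExcess, Set.indicator_of_mem (Set.mem_Ici.2 hy),
      Set.indicator_of_mem (Set.mem_Ici.2 (hy.trans hyz))]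
    exact Real.exp_le_exp.2 (by linarith)
  have hlogQ : ∀ y, s ≤ y →
      Real.log (tailQuantile μ (Real.exp y)) = γ * y + logSlowPart μ γ y := by
    intro y hy
    rw [logSlowPart, max_eq_left (hs1.trans hy)]
    ring
  have heq : hillSum (fun i => tailQuantile μ (Real.exp (x i))) k - γ * spacingSum x k =
      ∑ j ∈ Finset.Icc 1 k,
        (logSlowPart μ γ (orderStat x (n - j + 1)) - logSlowPart μ γ (orderStat x (n - k))) := by
    rw [← sum_mul_orderStat_sub hk x (logSlowPart μ γ), hillSum, spacingSum, Finset.mul_sum,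
      ← Finset.sum_sub_distrib]
    refine Finset.sum_congr rfl fun j hj => ?_
    rw [logSpacing_tailQuantile_exp hk hx hj]
    rw [Finset.mem_Icc] at hj
    rw [hlogQ _ (hs.trans (orderStat_le_orderStat x (by omega) (by omega) (by omega))),
      hlogQ _ (hs.trans (orderStat_le_orderStat x (by omega) (by omega) (by omega)))]
    ring
  rw [heq]
  calc _ ≤ ∑ j ∈ Finset.Icc 1 k, |logSlowPart μ γ (orderStat x (n - j + 1)) -
        logSlowPart μ γ (orderStat x (n - k))| := Finset.abs_sum_le_sum_abs _ _
    _ ≤ ∑ j ∈ Finset.Icc 1 k, 2 * A * expExcess s (orderStat x (n - j + 1)) := by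
      refine Finset.sum_le_sum fun j hj => ?_
      rw [Finset.mem_Icc] at hj
      have hle : orderStat x (n - k) ≤ orderStat x (n - j + 1) :=
        orderStat_le_orderStat x (by omega) (by omega) (by omega)
      have h1 := hbd' _ hs
      have h2 := hbd' _ (hs.trans hle)
      have h3 := mul_le_mul_of_nonneg_left (hexc _ _ hs hle) hA
      have h4 := abs_sub_le (logSlowPart μ γ (orderStat x (n - j + 1))) (logSlowPart μ γ s)
        (logSlowPart μ γ (orderStat x (n - k)))
      rw [abs_sub_comm (logSlowPart μ γ s)] at h4
      linarith
    _ = 2 * A * ∑ j ∈ Finset.Icc 1 k, expExcess s (orderStat x (n - j + 1)) :=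
      (Finset.mul_sum _ _ _).symm
    _ ≤ _ := mul_le_mul_of_nonneg_left (sum_orderStat_le hk.le x (expExcess_nonneg s))
        (by positivity)

end Deterministic

/-! ### Tools for convergence in probability and in distribution -/

section Convergence

variable {Ω Ω' : Type*} [MeasurableSpace Ω] {P : Measure Ω} [IsProbabilityMeasure P]
  [MeasurableSpace Ω'] {P' : Measure Ω'} [IsProbabilityMeasure P']

lemma tendstoInMeasure_zero_of_measureReal_le {R : ℕ → Ω → ℝ} {a r : ℕ → ℝ} {c : ℝ}
    (ha : Tendsto a atTop (𝓝 0)) (hr : Tendsto r atTop (𝓝 0))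
    (h : ∀ᶠ n in atTop, ∀ M : ℝ, 0 < M → P.real {ω | a n * M < |R n ω|} ≤ r n + c / M) :
    TendstoInMeasure P R atTop (fun _ => 0) := by
  rw [tendstoInMeasure_iff_measureReal_norm]
  intro ε hε
  rw [Metric.tendsto_nhds]
  intro δ hδ
  have hM : 0 < 2 * |c| / δ + 1 := by positivity
  set M := 2 * |c| / δ + 1 with hMdef
  have hcM : c / M < δ / 2 := by
    rw [div_lt_iff₀ hM, hMdef]
    have : δ / 2 * (2 * |c| / δ + 1) = |c| + δ / 2 := by field_simp
    rw [this]
    linarith [le_abs_self c]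
  have haM : Tendsto (fun n => a n * M) atTop (𝓝 0) := by simpa using ha.mul_const M
  filter_upwards [h, haM.eventually_lt_const hε, hr.eventually_lt_const (half_pos hδ)]
    with n h1 h2 h3
  rw [Real.dist_0_eq_abs, abs_of_nonneg measureReal_nonneg]
  calc _ ≤ P.real {ω | a n * M < |R n ω|} := measureReal_mono fun ω hω => by
        rw [Set.mem_ofPred_eq, sub_zero, Real.norm_eq_abs] at hω
        exact h2.trans_le hω
    _ ≤ r n + c / M := h1 M hM
    _ < δ := by linarith

lemma tendstoInDistribution_of_eventually_map_eq {X : ℕ → Ω → ℝ} {Y : ℕ → Ω' → ℝ} {ν : Measure ℝ}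
    [IsProbabilityMeasure ν] (hX : ∀ n, Measurable (X n))
    (hY : TendstoInDistribution Y atTop (id : ℝ → ℝ) (fun _ => P') ν)
    (h : ∀ᶠ n in atTop, P.map (X n) = P'.map (Y n)) :
    TendstoInDistribution X atTop (id : ℝ → ℝ) (fun _ => P) ν where
  forall_aemeasurable n := (hX n).aemeasurable
  aemeasurable_limit := hY.aemeasurable_limit
  tendsto := hY.tendsto.congr' (h.mono fun _ hn => Subtype.ext hn.symm)

end Convergence

lemma tendsto_div_atTop_of_tendsto_div_zero {k : ℕ → ℕ} (hk : Tendsto k atTop atTop)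
    (hkn : Tendsto (fun n => (k n : ℝ) / n) atTop (𝓝 0)) :
    Tendsto (fun n : ℕ => (n : ℝ) / k n) atTop atTop := by
  have h : Tendsto (fun n => (k n : ℝ) / n) atTop (𝓝[>] 0) := by
    refine tendsto_nhdsWithin_iff.2 ⟨hkn, ?_⟩
    filter_upwards [hk.eventually_gt_atTop 0, eventually_gt_atTop 0] with n h1 h2
    have : (0 : ℝ) < k n := by exact_mod_cast h1
    have : (0 : ℝ) < n := by exact_mod_cast h2
    exact Set.mem_Ioi.2 (by positivity)
  refine h.inv_tendsto_nhdsGT_zero.congr fun n => ?_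
  simp

lemma measurableSet_goodSample (n k : ℕ) (γ : ℝ) :
    MeasurableSet {x : Fin n → ℝ | (∀ j ∈ Finset.Icc 1 k, 0 ≤ logSpacing x j) ∧
      hillSum x k ≤ 2 * γ * k} := by
  have h : MeasurableSet {x : Fin n → ℝ | ∀ j ∈ Finset.Icc 1 k, 0 ≤ logSpacing x j} := by
    simp only [Set.ofPred_forall]
    exact MeasurableSet.iInter fun j => MeasurableSet.iInter fun _ =>
      measurableSet_le measurable_const (measurable_logSpacing n j)
  exact h.inter (measurableSet_le (measurable_hillSum n k) measurable_const)

/-! ### Asymptotic normality of the Hill estimator -/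

section Hill

variable {Ω Ω' : Type*} [MeasurableSpace Ω] {P : Measure Ω} [IsProbabilityMeasure P]
  [MeasurableSpace Ω'] {P' : Measure Ω'} [IsProbabilityMeasure P']
  {μ : Measure ℝ} {γ : ℝ} {ℓ b : ℝ → ℝ} {ρ : ℝ} {k : ℕ → ℕ} {E : ℕ → Ω → ℝ}

/-- At threshold `log (n/k) - log 2`, the term `2/k` pays for too few exceedances and `4/M` for a
large total excess. Keeping `M` free serves two ends: arbitrary `M` for the central limit theorem,
`M = √k` for the crude bound on the Hill sum. -/
lemma exists_measureReal_hillSum_le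
    (hU : ∀ᶠ x in atTop, tailQuantile μ x = x ^ γ * ℓ x) (hℓ : ∀ᶠ x in atTop, 0 < ℓ x)
    (hb : SecondOrderCondition ℓ b ρ)
    (hk : Tendsto k atTop atTop) (hkn : Tendsto (fun n => (k n : ℝ) / n) atTop (𝓝 0))
    (hEm : ∀ i, Measurable (E i)) (hE : ∀ i, P.map (E i) = expMeasure 1)
    (hind : iIndepFun E P) :
    ∃ C : ℝ, ∀ᶠ n in atTop, ∀ M : ℝ, 0 < M →
      P.real {ω | ¬ ((∀ j ∈ Finset.Icc 1 (k n),
          0 ≤ logSpacing (fun i : Fin n => tailQuantile μ (Real.exp (E i ω))) j) ∧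
        |hillSum (fun i : Fin n => tailQuantile μ (Real.exp (E i ω))) (k n) -
          γ * spacingSum (fun i : Fin n => E i ω) (k n)| ≤
          C * |b ((n : ℝ) / k n)| * (M * k n))} ≤ 2 / k n + 4 / M := by
  obtain ⟨C, hC0, hC⟩ := exists_logSlowPart_bound hU hℓ hb
  have hnk := tendsto_div_atTop_of_tendsto_div_zero hk hkn
  have hlog : Tendsto (fun n : ℕ => Real.log ((n : ℝ) / k n)) atTop atTop :=
    Real.tendsto_log_atTop.comp hnk
  have hs : Tendsto (fun n : ℕ => Real.log ((n : ℝ) / k n) - Real.log 2) atTop atTop :=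
    tendsto_atTop_add_const_right _ (-Real.log 2) hlog
  obtain ⟨y0, hy0⟩ := eventually_atTop.1 (eventually_tailQuantile_exp_pos hU hℓ)
  have hpos : ∀ᵐ ω ∂P, ∀ i, 0 < E i ω := by
    refine ae_all_iff.2 fun i => ?_
    have := ae_pos_expMeasure
    rw [← hE i] at this
    exact ae_of_ae_map (hEm i).aemeasurable this
  have hnull : P.real {ω | ¬ ∀ i, 0 < E i ω} = 0 := by
    rw [Measure.real, ae_iff.1 hpos, ENNReal.toReal_zero]
  refine ⟨2 * C, ?_⟩
  filter_upwards [hlog.eventually hC, hs.eventually_ge_atTop (max 1 y0),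
    hk.eventually_gt_atTop 0, hnk.eventually_gt_atTop 1] with n h1 h2 h3 h4 M hM
  have hkpos : (0 : ℝ) < k n := by exact_mod_cast h3
  have hkn' : k n < n := by
    rw [lt_div_iff₀ hkpos, one_mul] at h4
    exact_mod_cast h4
  set s := Real.log ((n : ℝ) / k n) - Real.log 2 with hsdef
  have hexp : Real.exp (Real.log ((n : ℝ) / k n)) = n / k n := Real.exp_log (by linarith)
  rw [hexp] at h1
  have hs1 : 1 ≤ s := (le_max_left _ _).trans h2
  have hns : n * Real.exp (-s) = 2 * k n := by
    rw [hsdef, neg_sub, Real.exp_sub, Real.exp_log (by norm_num), hexp]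
    have : (n : ℝ) ≠ 0 := by
      have : 0 < n := by omega
      positivity
    field_simp
  have hA := measureReal_card_le hEm hE hind h3 (by linarith) hns
  have hB := measureReal_sum_expExcess_gt_le hEm hE h3 (by linarith) hns hM
  calc _ ≤ P.real ({ω | ¬ ∀ i, 0 < E i ω} ∪
        ({ω | (Finset.univ.filter fun i : Fin n => s ≤ E i ω).card ≤ k n} ∪
          {ω | M * k n < ∑ i : Fin n, expExcess s (E i ω)})) := measureReal_mono ?_
    _ ≤ _ := measureReal_union_le _ _
    _ ≤ 0 + (2 / k n + 4 / M) := by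
        rw [hnull]
        gcongr
        exact (measureReal_union_le _ _).trans (add_le_add hA hB)
    _ = _ := zero_add _
  intro ω hω
  by_contra hcon
  simp only [Set.mem_union, Set.mem_ofPred_eq, not_or, not_not, not_le, not_lt] at hcon
  obtain ⟨hp, hc, he⟩ := hcon
  have hx : ∀ i : Fin n, E i ω ∈ Set.Ioi (0 : ℝ) := fun i => hp i
  have hso := le_orderStat_of_card hkn' (fun i : Fin n => E i ω) hc
  refine hω ⟨fun j hj => ?_, ?_⟩
  · exact logSpacing_tailQuantile_exp_nonneg hkn' hx hso
      (fun y hy => hy0 y (((le_max_right _ _).trans h2).trans hy)) hj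
  · refine (abs_hillSum_sub_le (A := C * |b (n / k n)|) (by positivity) hkn' hx hs1 hso h1).trans ?_
    calc _ ≤ 2 * (C * |b (n / k n)|) * (M * k n) := by gcongr
      _ = _ := by ring

lemma sqrt_mul_tendsto_abs {k : ℕ → ℕ}
    (hslope : Tendsto (fun n => Real.sqrt (k n) * b ((n : ℝ) / k n)) atTop (𝓝 0)) (c : ℝ) :
    Tendsto (fun n => c * (Real.sqrt (k n) * |b ((n : ℝ) / k n)|)) atTop (𝓝 0) := by
  have := hslope.abs.const_mul c
  simpa [abs_mul, abs_of_nonneg (Real.sqrt_nonneg _)] using this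

lemma tendstoInDistribution_spacingSum
    (hk : Tendsto k atTop atTop) (hkn : Tendsto (fun n => (k n : ℝ) / n) atTop (𝓝 0))
    (hEm : ∀ i, Measurable (E i)) (hE : ∀ i, P.map (E i) = expMeasure 1)
    (hind : iIndepFun E P) :
    TendstoInDistribution
      (fun n ω => (√(k n))⁻¹ * (spacingSum (fun i : Fin n => E i ω) (k n) - k n)) atTop
      (id : ℝ → ℝ) (fun _ => P) (gaussianReal 0 1) := by
  have hclt := tendstoInDistribution_sum_exp hEm hE hind
  have hclt' : TendstoInDistribution
      (fun (n : ℕ) ω => (√(k n))⁻¹ * (∑ j ∈ Finset.range (k n), E j ω - k n)) atTop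
      (id : ℝ → ℝ) (fun _ => P) (gaussianReal 0 1) :=
    ⟨fun n => hclt.forall_aemeasurable (k n), hclt.aemeasurable_limit, hclt.tendsto.comp hk⟩
  have hsp : ∀ n, Measurable fun ω => spacingSum (fun i : Fin n => E i ω) (k n) := fun n =>
    (measurable_spacingSum n (k n)).comp (measurable_pi_lambda _ fun i => hEm i)
  refine tendstoInDistribution_of_eventually_map_eq
    (fun n => ((hsp n).sub measurable_const).const_mul _) hclt' ?_
  have hnk := tendsto_div_atTop_of_tendsto_div_zero hk hkn
  filter_upwards [hnk.eventually_gt_atTop 1, hk.eventually_gt_atTop 0] with n h1 h2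
  have hkn' : k n < n := by
    rw [lt_div_iff₀ (by exact_mod_cast h2), one_mul] at h1
    exact_mod_cast h1
  have hφ : Measurable fun z : ℝ => (√(k n))⁻¹ * (z - k n) := by fun_prop
  have hsum : Measurable fun ω => ∑ j ∈ Finset.range (k n), E j ω :=
    Finset.measurable_fun_sum _ fun j _ => hEm j
  have := congrArg (Measure.map fun z : ℝ => (√(k n))⁻¹ * (z - k n)) (map_spacingSum hEm hE hind hkn')
  rwa [Measure.map_map hφ (hsp n), Measure.map_map hφ hsum] at this

lemma tendstoInDistribution_hillSum_exp [IsProbabilityMeasure μ] (hγ : 0 < γ)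
    (hU : ∀ᶠ x in atTop, tailQuantile μ x = x ^ γ * ℓ x) (hℓ : ∀ᶠ x in atTop, 0 < ℓ x)
    (hb : SecondOrderCondition ℓ b ρ)
    (hk : Tendsto k atTop atTop) (hkn : Tendsto (fun n => (k n : ℝ) / n) atTop (𝓝 0))
    (hslope : Tendsto (fun n => Real.sqrt (k n) * b ((n : ℝ) / k n)) atTop (𝓝 0))
    (hEm : ∀ i, Measurable (E i)) (hE : ∀ i, P.map (E i) = expMeasure 1)
    (hind : iIndepFun E P) :
    TendstoInDistribution
      (fun n ω => (√(k n))⁻¹ *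
        (hillSum (fun i : Fin n => tailQuantile μ (Real.exp (E i ω))) (k n) / γ - k n)) atTop
      (id : ℝ → ℝ) (fun _ => P) (gaussianReal 0 1) := by
  have hmeas : ∀ n, Measurable fun ω =>
      hillSum (fun i : Fin n => tailQuantile μ (Real.exp (E i ω))) (k n) := fun n =>
    (measurable_hillSum n (k n)).comp
      (measurable_pi_lambda _ fun i => (measurable_tailQuantile_exp μ).comp (hEm i))
  obtain ⟨C, hC⟩ := exists_measureReal_hillSum_le hU hℓ hb hk hkn hEm hE hind
  refine tendstoInDistribution_of_tendstoInMeasure_sub _ _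
    (tendstoInDistribution_spacingSum hk hkn hEm hE hind) ?_
    (fun n => (((hmeas n).div_const _).sub measurable_const).const_mul _ |>.aemeasurable)
  have hk2 : Tendsto (fun n => 2 / (k n : ℝ)) atTop (𝓝 0) :=
    tendsto_const_nhds.div_atTop (tendsto_natCast_atTop_atTop.comp hk)
  refine tendstoInMeasure_zero_of_measureReal_le (sqrt_mul_tendsto_abs hslope (C / γ)) hk2
    (c := 4) ?_
  filter_upwards [hC, hk.eventually_gt_atTop 0] with n hn hk0 M hM
  refine (measureReal_mono ?_).trans (hn M hM)
  intro ω hω hgood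
  have hkpos : (0 : ℝ) < k n := by exact_mod_cast hk0
  have hsq : 0 < √(k n : ℝ) := Real.sqrt_pos.2 hkpos
  rw [Set.mem_ofPred_eq] at hω
  refine absurd hω (not_lt.2 ?_)
  simp only [Pi.sub_apply]
  rw [← mul_sub, abs_mul, abs_of_pos (inv_pos.2 hsq)]
  have h1 : hillSum (fun i : Fin n => tailQuantile μ (Real.exp (E i ω))) (k n) / γ - k n -
      (spacingSum (fun i : Fin n => E i ω) (k n) - k n) =
      (hillSum (fun i : Fin n => tailQuantile μ (Real.exp (E i ω))) (k n) -
        γ * spacingSum (fun i : Fin n => E i ω) (k n)) / γ := by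
    field_simp
    ring
  rw [h1, abs_div, abs_of_pos hγ]
  calc _ ≤ (√(k n : ℝ))⁻¹ * (C * |b (n / k n)| * (M * k n) / γ) := by
        gcongr
        exact hgood.2
    _ = (√(k n : ℝ))⁻¹ * (C * |b (n / k n)| * (M * (√(k n : ℝ) * √(k n : ℝ))) / γ) := by
        rw [Real.mul_self_sqrt hkpos.le]
    _ = _ := by
        field_simp

lemma tendsto_measureReal_hillSum_exp (hγ : 0 < γ)
    (hU : ∀ᶠ x in atTop, tailQuantile μ x = x ^ γ * ℓ x) (hℓ : ∀ᶠ x in atTop, 0 < ℓ x)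
    (hb : SecondOrderCondition ℓ b ρ)
    (hk : Tendsto k atTop atTop) (hkn : Tendsto (fun n => (k n : ℝ) / n) atTop (𝓝 0))
    (hslope : Tendsto (fun n => Real.sqrt (k n) * b ((n : ℝ) / k n)) atTop (𝓝 0))
    (hEm : ∀ i, Measurable (E i)) (hE : ∀ i, P.map (E i) = expMeasure 1)
    (hind : iIndepFun E P) :
    Tendsto (fun n => P.real {ω | ¬ ((∀ j ∈ Finset.Icc 1 (k n),
          0 ≤ logSpacing (fun i : Fin n => tailQuantile μ (Real.exp (E i ω))) j) ∧
        hillSum (fun i : Fin n => tailQuantile μ (Real.exp (E i ω))) (k n) ≤ 2 * γ * k n)})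
      atTop (𝓝 0) := by
  obtain ⟨C, hC⟩ := exists_measureReal_hillSum_le hU hℓ hb hk hkn hEm hE hind
  have hkr : Tendsto (fun n => (k n : ℝ)) atTop atTop := tendsto_natCast_atTop_atTop.comp hk
  have hb1 : Tendsto (fun n => 2 / (k n : ℝ) + 4 / √(k n) + 4 / k n) atTop (𝓝 0) := by
    have h1 : Tendsto (fun n => 2 / (k n : ℝ)) atTop (𝓝 0) := tendsto_const_nhds.div_atTop hkr
    have h2 : Tendsto (fun n => 4 / √(k n : ℝ)) atTop (𝓝 0) :=
      tendsto_const_nhds.div_atTop (Real.tendsto_sqrt_atTop.comp hkr)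
    have h3 : Tendsto (fun n => 4 / (k n : ℝ)) atTop (𝓝 0) := tendsto_const_nhds.div_atTop hkr
    simpa using (h1.add h2).add h3
  refine squeeze_zero' (Eventually.of_forall fun n => measureReal_nonneg) ?_ hb1
  have hnk := tendsto_div_atTop_of_tendsto_div_zero hk hkn
  filter_upwards [hC, hk.eventually_gt_atTop 0, hnk.eventually_gt_atTop 1,
    (sqrt_mul_tendsto_abs hslope C).eventually_lt_const (u := γ / 2) (by positivity)]
    with n hn hk0 h1 h2
  have hkpos : (0 : ℝ) < k n := by exact_mod_cast hk0
  have hkn' : k n < n := by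
    rw [lt_div_iff₀ hkpos, one_mul] at h1
    exact_mod_cast h1
  have hsq : 0 < √(k n : ℝ) := Real.sqrt_pos.2 hkpos
  have hcheb : P.real {ω | (k n : ℝ) / 2 ≤ |spacingSum (fun i : Fin n => E i ω) (k n) - k n|} ≤
      4 / k n := by
    have hmeas : MeasurableSet {z : ℝ | (k n : ℝ) / 2 ≤ |z - k n|} :=
      measurableSet_le measurable_const (by fun_prop)
    have hsp : Measurable fun ω => spacingSum (fun i : Fin n => E i ω) (k n) :=
      (measurable_spacingSum n (k n)).comp (measurable_pi_lambda _ fun i => hEm i)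
    have hsum : Measurable fun ω => ∑ j ∈ Finset.range (k n), E j ω :=
      Finset.measurable_fun_sum _ fun j _ => hEm j
    have h3 := congrArg (fun ν : Measure ℝ => ν.real {z : ℝ | (k n : ℝ) / 2 ≤ |z - k n|})
      (map_spacingSum hEm hE hind hkn')
    rw [map_measureReal_apply hsp hmeas, map_measureReal_apply hsum hmeas] at h3
    refine h3.le.trans ((measureReal_abs_sum_exp_sub_ge_le hEm hE hind (k n)
      (by positivity : (0 : ℝ) < k n / 2)).trans (le_of_eq ?_))
    field_simp
    norm_num
  -- With `M = √k` the bias is at most `γ k / 2`, and off the Chebyshev event the spacing sum is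
  -- below `3 k / 2`; together they give `2 γ k`.
  calc _ ≤ P.real ({ω | ¬ ((∀ j ∈ Finset.Icc 1 (k n),
          0 ≤ logSpacing (fun i : Fin n => tailQuantile μ (Real.exp (E i ω))) j) ∧
        |hillSum (fun i : Fin n => tailQuantile μ (Real.exp (E i ω))) (k n) -
          γ * spacingSum (fun i : Fin n => E i ω) (k n)| ≤
          C * |b ((n : ℝ) / k n)| * (√(k n : ℝ) * k n))} ∪
        {ω | (k n : ℝ) / 2 ≤ |spacingSum (fun i : Fin n => E i ω) (k n) - k n|}) :=
        measureReal_mono ?_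
    _ ≤ _ := (measureReal_union_le _ _).trans (add_le_add (hn _ hsq) hcheb)
  intro ω hω
  by_contra hcon
  simp only [Set.mem_union, Set.mem_ofPred_eq, not_or, not_not, not_le] at hcon
  obtain ⟨⟨hT, hH⟩, hS⟩ := hcon
  refine hω ⟨hT, ?_⟩
  have h4 := (abs_le.1 hH).2
  have h5 := (abs_lt.1 hS).2
  have h6 : C * |b ((n : ℝ) / k n)| * (√(k n : ℝ) * k n) ≤ γ / 2 * k n := by
    calc _ = C * (√(k n : ℝ) * |b ((n : ℝ) / k n)|) * k n := by ring
      _ ≤ _ := by gcongr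
  nlinarith

variable {X : ℕ → Ω' → ℝ}

lemma map_fin_eq_map_tailQuantile_exp [IsProbabilityMeasure μ] (hXm : ∀ i, Measurable (X i))
    (hX : ∀ i, P'.map (X i) = μ) (hXind : iIndepFun X P') (hEm : ∀ i, Measurable (E i))
    (hE : ∀ i, P.map (E i) = expMeasure 1) (hind : iIndepFun E P) (n : ℕ) :
    P'.map (fun ω (i : Fin n) => X i ω) =
      P.map (fun ω (i : Fin n) => tailQuantile μ (Real.exp (E i ω))) := by
  have hQ := measurable_tailQuantile_exp μ
  rw [map_comp_eq_pi hXm hX hXind Fin.val_injective,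
    map_comp_eq_pi (E := fun i ω => tailQuantile μ (Real.exp (E i ω))) (ν := μ)
      (fun i => hQ.comp (hEm i)) (fun i => ?_)
      (hind.comp (fun _ y => tailQuantile μ (Real.exp y)) fun _ => hQ) Fin.val_injective]
  have := Measure.map_map (μ := P) hQ (hEm i)
  rw [hE, map_tailQuantile_exp] at this
  exact this.symm

/-- Asymptotic normality of the Hill estimator. -/
theorem tendstoInDistribution_hillSum [IsProbabilityMeasure μ] (hγ : 0 < γ)
    (hU : ∀ᶠ x in atTop, tailQuantile μ x = x ^ γ * ℓ x) (hℓ : ∀ᶠ x in atTop, 0 < ℓ x)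
    (hb : SecondOrderCondition ℓ b ρ)
    (hk : Tendsto k atTop atTop) (hkn : Tendsto (fun n => (k n : ℝ) / n) atTop (𝓝 0))
    (hslope : Tendsto (fun n => Real.sqrt (k n) * b ((n : ℝ) / k n)) atTop (𝓝 0))
    (hXm : ∀ i, Measurable (X i)) (hX : ∀ i, P'.map (X i) = μ) (hXind : iIndepFun X P') :
    TendstoInDistribution
      (fun n ω => (√(k n))⁻¹ * (hillSum (fun i : Fin n => X i ω) (k n) / γ - k n)) atTop
      (id : ℝ → ℝ) (fun _ => P') (gaussianReal 0 1) := by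
  have := isProbabilityMeasure_expMeasure one_pos
  -- The exponentials live on a space of their own: convergence in distribution sees only the law of
  -- the first `n` observations, for each `n`.
  obtain ⟨Ω₁, _, P₁, E, hEm, hE, hind, _⟩ := exists_iid ℕ (expMeasure 1)
  have hφ : ∀ n, Measurable fun x : Fin n → ℝ => (√(k n))⁻¹ * (hillSum x (k n) / γ - k n) :=
    fun n => (((measurable_hillSum n (k n)).div_const _).sub measurable_const).const_mul _
  have hXv : ∀ n, Measurable fun ω (i : Fin n) => X i ω := fun n =>
    measurable_pi_lambda _ fun i => hXm i
  refine tendstoInDistribution_of_eventually_map_eq (fun n => (hφ n).comp (hXv n))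
    (tendstoInDistribution_hillSum_exp hγ hU hℓ hb hk hkn hslope hEm (fun i => (hE i).map_eq) hind)
    (Eventually.of_forall fun n => ?_)
  have hEv : Measurable fun ω (i : Fin n) => tailQuantile μ (Real.exp (E i ω)) :=
    measurable_pi_lambda _ fun i => (measurable_tailQuantile_exp μ).comp (hEm i)
  have := congrArg (Measure.map fun x : Fin n → ℝ => (√(k n))⁻¹ * (hillSum x (k n) / γ - k n))
    (map_fin_eq_map_tailQuantile_exp hXm hX hXind hEm (fun i => (hE i).map_eq) hind n)
  rwa [Measure.map_map (hφ n) (hXv n), Measure.map_map (hφ n) hEv] at this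

theorem tendsto_measureReal_hillSum [IsProbabilityMeasure μ] (hγ : 0 < γ)
    (hU : ∀ᶠ x in atTop, tailQuantile μ x = x ^ γ * ℓ x) (hℓ : ∀ᶠ x in atTop, 0 < ℓ x)
    (hb : SecondOrderCondition ℓ b ρ)
    (hk : Tendsto k atTop atTop) (hkn : Tendsto (fun n => (k n : ℝ) / n) atTop (𝓝 0))
    (hslope : Tendsto (fun n => Real.sqrt (k n) * b ((n : ℝ) / k n)) atTop (𝓝 0))
    (hXm : ∀ i, Measurable (X i)) (hX : ∀ i, P'.map (X i) = μ) (hXind : iIndepFun X P') :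
    Tendsto (fun n => P'.real {ω | ¬ ((∀ j ∈ Finset.Icc 1 (k n),
          0 ≤ logSpacing (fun i : Fin n => X i ω) j) ∧
        hillSum (fun i : Fin n => X i ω) (k n) ≤ 2 * γ * k n)}) atTop (𝓝 0) := by
  have := isProbabilityMeasure_expMeasure one_pos
  obtain ⟨Ω₁, _, P₁, E, hEm, hE, hind, _⟩ := exists_iid ℕ (expMeasure 1)
  refine (tendsto_measureReal_hillSum_exp hγ hU hℓ hb hk hkn hslope hEm
    (fun i => (hE i).map_eq) hind).congr fun n => ?_
  have hXv : Measurable fun ω (i : Fin n) => X i ω := measurable_pi_lambda _ fun i => hXm i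
  have hEv : Measurable fun ω (i : Fin n) => tailQuantile μ (Real.exp (E i ω)) :=
    measurable_pi_lambda _ fun i => (measurable_tailQuantile_exp μ).comp (hEm i)
  have hS : MeasurableSet {x : Fin n → ℝ | ¬ ((∀ j ∈ Finset.Icc 1 (k n), 0 ≤ logSpacing x j) ∧
      hillSum x (k n) ≤ 2 * γ * k n)} :=
    (measurableSet_goodSample n (k n) γ).compl
  have := congrArg (fun ν : Measure (Fin n → ℝ) =>
    ν.real {x : Fin n → ℝ | ¬ ((∀ j ∈ Finset.Icc 1 (k n), 0 ≤ logSpacing x j) ∧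
      hillSum x (k n) ≤ 2 * γ * k n)})
    (map_fin_eq_map_tailQuantile_exp hXm hX hXind hEm (fun i => (hE i).map_eq) hind n)
  beta_reduce at this
  rw [map_measureReal_apply hXv hS, map_measureReal_apply hEv hS] at this
  exact this.symm

end Hill

/-! ### Deterministic comparison of the weighted estimator with Hill's -/

lemma sum_inv_sqrt_le (k : ℕ) : ∑ j ∈ Finset.Icc 1 k, (√(j : ℝ))⁻¹ ≤ 2 * √k := by
  induction k with
  | zero => simp
  | succ k ih =>
    rw [Finset.sum_Icc_succ_top (by omega)]
    refine (add_le_add_left ih _).trans ?_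
    have h1 : 0 < √((k + 1 : ℕ) : ℝ) := Real.sqrt_pos.2 (by positivity)
    have h2 : √((k + 1 : ℕ) : ℝ) ^ 2 = k + 1 := by
      rw [Real.sq_sqrt (by positivity)]
      push_cast
      ring
    have h3 : √(k : ℝ) ^ 2 = k := Real.sq_sqrt (by positivity)
    have h4 : 2 * √(k : ℝ) * √((k + 1 : ℕ) : ℝ) + 1 ≤ 2 * √((k + 1 : ℕ) : ℝ) ^ 2 := by
      nlinarith [sq_nonneg (√((k + 1 : ℕ) : ℝ) - √(k : ℝ))]
    rw [← le_sub_iff_add_le', inv_le_iff_one_le_mul₀ h1]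
    nlinarith

lemma sum_Icc_div_succ (k : ℕ) : ∑ j ∈ Finset.Icc 1 k, (j : ℝ) / (k + 1) = k / 2 := by
  rw [← Finset.sum_div]
  have h : ∀ m : ℕ, ∑ j ∈ Finset.Icc 1 m, (j : ℝ) = m * (m + 1) / 2 := by
    intro m
    induction m with
    | zero => simp
    | succ m ih =>
      rw [Finset.sum_Icc_succ_top (by omega), ih]
      push_cast
      ring
  rw [h]
  field_simp

section Weights

variable {k : ℕ} {a : ℝ} {θ : ℕ → ℝ}

lemma weightDefect_mem (ha : 0 ≤ a) (hθ : ∀ j, θ j ∈ Set.Icc (0 : ℝ) 1) {j : ℕ}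
    (hj : j ∈ Finset.Icc 1 k) :
    0 ≤ θ j ^ a * ((j : ℝ) / (k + 1)) ∧ θ j ^ a * ((j : ℝ) / (k + 1)) ≤ (j : ℝ) / (k + 1) ∧
      (j : ℝ) / (k + 1) ≤ 1 := by
  have h0 := Real.rpow_nonneg (hθ j).1 a
  have h1 := Real.rpow_le_one (hθ j).1 (hθ j).2 ha
  rw [Finset.mem_Icc] at hj
  have hj2 : (j : ℝ) ≤ k := by exact_mod_cast hj.2
  refine ⟨by positivity, mul_le_of_le_one_left (by positivity) h1, ?_⟩
  rw [div_le_one (by positivity)]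
  linarith

lemma weight_mem_Icc (ha : 0 ≤ a) (hθ : ∀ j, θ j ∈ Set.Icc (0 : ℝ) 1) {j : ℕ}
    (hj : j ∈ Finset.Icc 1 k) : weight k a θ j ∈ Set.Icc (0 : ℝ) 1 := by
  obtain ⟨h1, h2, h3⟩ := weightDefect_mem ha hθ hj
  rw [weight]
  constructor <;> linarith

lemma sum_weight : ∑ j ∈ Finset.Icc 1 k, weight k a θ j =
    k - ∑ j ∈ Finset.Icc 1 k, θ j ^ a * ((j : ℝ) / (k + 1)) := by
  simp [weight, Finset.sum_sub_distrib]

lemma half_le_sum_weight (ha : 0 ≤ a) (hθ : ∀ j, θ j ∈ Set.Icc (0 : ℝ) 1) :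
    (k : ℝ) / 2 ≤ ∑ j ∈ Finset.Icc 1 k, weight k a θ j := by
  have := Finset.sum_le_sum fun j (hj : j ∈ Finset.Icc 1 k) => (weightDefect_mem ha hθ hj).2.1
  rw [sum_Icc_div_succ] at this
  rw [sum_weight]
  linarith

lemma covariate_le {r : ℝ} (hr : r ≤ 1 / 2) {j : ℕ} (hj : j ∈ Finset.Icc 1 k) :
    covariate k r j ≤ √((k : ℝ) + 1) * (√(j : ℝ))⁻¹ := by
  rw [Finset.mem_Icc] at hj
  have hj0 : (0 : ℝ) < j := by exact_mod_cast hj.1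
  have hj2 : (j : ℝ) ≤ k := by exact_mod_cast hj.2
  calc covariate k r j ≤ ((j : ℝ) / (k + 1)) ^ (-(1 / 2) : ℝ) :=
        Real.rpow_le_rpow_of_exponent_ge (by positivity)
          ((div_le_one (by positivity)).2 (by linarith)) (by linarith)
    _ = _ := by
        rw [Real.rpow_neg (by positivity), ← Real.sqrt_eq_rpow, Real.sqrt_div hj0.le, inv_div]
        rfl

/-- Normalised weights are at most `2/k`, and for `r ≤ 1/2` the covariates are at most `√((k + 1) /
j)`, whose sum is at most `2 (k + 1)`. The product `4 (k + 1) / k` is at most `8`. -/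
lemma weightedMeanC_mem_Icc (hk : 0 < k) (ha : 0 ≤ a) (hθ : ∀ j, θ j ∈ Set.Icc (0 : ℝ) 1) {r : ℝ}
    (hr : r ≤ 1 / 2) : weightedMeanC k a θ r ∈ Set.Icc (0 : ℝ) 8 := by
  have hkpos : (1 : ℝ) ≤ k := by exact_mod_cast hk
  have hS := half_le_sum_weight (k := k) ha hθ
  have hSpos : 0 < ∑ j ∈ Finset.Icc 1 k, weight k a θ j := by linarith
  have hc0 : ∀ j, 0 ≤ covariate k r j := fun j => Real.rpow_nonneg (by positivity) _
  have hw : ∀ j ∈ Finset.Icc 1 k, 0 ≤ normWeight k a θ j ∧ normWeight k a θ j ≤ 2 / k := by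
    intro j hj
    have h1 := weight_mem_Icc ha hθ hj
    refine ⟨div_nonneg h1.1 hSpos.le, ?_⟩
    rw [normWeight, div_le_div_iff₀ hSpos (by linarith)]
    nlinarith [h1.1, h1.2]
  constructor
  · exact Finset.sum_nonneg fun j hj => mul_nonneg (hw j hj).1 (hc0 j)
  · calc weightedMeanC k a θ r
        ≤ ∑ j ∈ Finset.Icc 1 k, 2 / k * (√((k : ℝ) + 1) * (√(j : ℝ))⁻¹) :=
          Finset.sum_le_sum fun j hj =>
            mul_le_mul (hw j hj).2 (covariate_le hr hj) (hc0 j) (by positivity)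
      _ = 2 / k * (√((k : ℝ) + 1) * ∑ j ∈ Finset.Icc 1 k, (√(j : ℝ))⁻¹) := by
          rw [Finset.mul_sum, Finset.mul_sum]
      _ ≤ 2 / k * (√((k : ℝ) + 1) * (2 * √((k : ℝ) + 1))) := by
          gcongr
          exact (sum_inv_sqrt_le k).trans (by gcongr; linarith)
      _ = 2 / k * (2 * (k + 1)) := by
          have := Real.mul_self_sqrt (show (0 : ℝ) ≤ k + 1 by positivity)
          rw [mul_left_comm (√((k : ℝ) + 1)), this]
      _ ≤ 8 := by
          rw [div_mul_eq_mul_div, div_le_iff₀ (by linarith)]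
          linarith

/-- With `D` the total weight defect and `R` its `T`-weighted version, the weighted mean is `(H - R)
/ (k - D)`. Since `k - D ≥ k/2` and `|H/γ - k| ≤ k`, replacing it by `H / k` costs at most `4 D + 2
R / γ` on the scale of `k`; then `j / (k + 1) ≤ 1` is dropped. The slope estimate enters only
through its size. -/
lemma abs_gammaRW_sub_hillSum_le {n : ℕ} {x : Fin n → ℝ} {γ r lam : ℝ} (hγ : 0 < γ) (hk : 0 < k)
    (ha : 0 ≤ a) (hθ : ∀ j, θ j ∈ Set.Icc (0 : ℝ) 1) (hr : r ≤ 1 / 2)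
    (hT : ∀ j ∈ Finset.Icc 1 k, 0 ≤ logSpacing x j) (hH : hillSum x k ≤ 2 * γ * k) :
    |√(k : ℝ) * (gammaRW x k a θ r lam - γ) / γ - (√(k : ℝ))⁻¹ * (hillSum x k / γ - k)| ≤
      (√(k : ℝ))⁻¹ * ∑ j ∈ Finset.Icc 1 k, θ j ^ a * (4 + 2 / γ * logSpacing x j) +
        8 / γ * |√(k : ℝ) * bHat x k a θ r lam| := by
  have hkpos : (0 : ℝ) < k := by exact_mod_cast hk
  have hsq : 0 < √(k : ℝ) := Real.sqrt_pos.2 hkpos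
  have hsq2 : √(k : ℝ) * √(k : ℝ) = k := Real.mul_self_sqrt hkpos.le
  set D := ∑ j ∈ Finset.Icc 1 k, θ j ^ a * ((j : ℝ) / (k + 1)) with hD
  set R := ∑ j ∈ Finset.Icc 1 k, θ j ^ a * ((j : ℝ) / (k + 1)) * logSpacing x j with hR
  set β := bHat x k a θ r lam with hβ
  set S1 := weightedMeanC k a θ r with hS1
  set H := hillSum x k with hHdef
  have hS := half_le_sum_weight (k := k) ha hθ
  rw [sum_weight, ← hD] at hS
  have hH0 : 0 ≤ H := Finset.sum_nonneg hT
  have hD0 : 0 ≤ D := Finset.sum_nonneg fun j hj => (weightDefect_mem ha hθ hj).1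
  have hR0 : 0 ≤ R := Finset.sum_nonneg fun j hj =>
    mul_nonneg (weightDefect_mem ha hθ hj).1 (hT j hj)
  have hmean : ∑ j ∈ Finset.Icc 1 k, normWeight k a θ j * logSpacing x j = (H - R) / (k - D) := by
    simp only [normWeight, sum_weight, ← hD, div_mul_eq_mul_div]
    rw [← Finset.sum_div]
    congr 1
    rw [hHdef, hR, hillSum, ← Finset.sum_sub_distrib]
    refine Finset.sum_congr rfl fun j _ => ?_
    rw [weight]
    ring
  have hkD : 0 < k - D := by linarith
  have hg : gammaRW x k a θ r lam = (H - R) / (k - D) - β * S1 := by rw [gammaRW, hmean]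
  have hS1b := weightedMeanC_mem_Icc hk ha hθ hr
  rw [← hS1] at hS1b
  have hsum : 4 * D + 2 / γ * R ≤
      ∑ j ∈ Finset.Icc 1 k, θ j ^ a * (4 + 2 / γ * logSpacing x j) := by
    rw [hD, hR, Finset.mul_sum, Finset.mul_sum, ← Finset.sum_add_distrib]
    refine Finset.sum_le_sum fun j hj => ?_
    have h0 := Real.rpow_nonneg (hθ j).1 a
    have h1 := (weightDefect_mem ha hθ hj).2.2
    have h2 : 0 ≤ 4 + 2 / γ * logSpacing x j := by
      have := hT j hj
      positivity
    calc _ = θ j ^ a * (4 + 2 / γ * logSpacing x j) * ((j : ℝ) / (k + 1)) := by ring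
      _ ≤ _ := mul_le_of_le_one_right (mul_nonneg h0 h2) h1
  have heq : √(k : ℝ) * (gammaRW x k a θ r lam - γ) / γ - (√(k : ℝ))⁻¹ * (H / γ - k) =
      (√(k : ℝ))⁻¹ * (((D - R / γ) * k + (H / γ - k) * D) / (k - D)) -
        S1 / γ * (√(k : ℝ) * β) := by
    rw [hg]
    have hne := hkD.ne'
    have hsk : √(k : ℝ) = (√(k : ℝ))⁻¹ * k := by
      rw [eq_inv_mul_iff_mul_eq₀ hsq.ne', hsq2]
    have e1 : √(k : ℝ) * ((H - R) / (k - D) - β * S1 - γ) / γ =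
        √(k : ℝ) * (((H - R) / (k - D) - γ) / γ) - S1 / γ * (√(k : ℝ) * β) := by
      field_simp
      ring
    have e2 : k * (((H - R) / (k - D) - γ) / γ) - (H / γ - k) =
        ((D - R / γ) * k + (H / γ - k) * D) / (k - D) := by
      field_simp
      ring
    rw [e1, ← e2]
    nth_rewrite 1 [hsk]
    ring
  have hHk : |H / γ - k| ≤ k := by
    rw [abs_le]
    have h1 : 0 ≤ H / γ := by positivity
    have h2 : H / γ ≤ 2 * k := by
      rw [div_le_iff₀ hγ]
      linarith
    constructor <;> linarith
  have hfrac : |((D - R / γ) * k + (H / γ - k) * D) / (k - D)| ≤ 4 * D + 2 / γ * R := by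
    have hRγ : 0 ≤ R / γ := by positivity
    have h1 : |D - R / γ| ≤ D + R / γ := by
      rw [abs_le]
      constructor <;> linarith
    rw [abs_div, abs_of_pos hkD, div_le_iff₀ hkD]
    calc |(D - R / γ) * k + (H / γ - k) * D|
        ≤ |D - R / γ| * k + |H / γ - k| * D := by
          refine (abs_add_le _ _).trans (le_of_eq ?_)
          rw [abs_mul, abs_mul, abs_of_pos hkpos, abs_of_nonneg hD0]
      _ ≤ (D + R / γ) * k + k * D := by gcongr
      _ = (4 * D + 2 / γ * R) * (k / 2) := by ring
      _ ≤ _ := by gcongr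
  rw [heq]
  refine (abs_sub _ _).trans (add_le_add ?_ ?_)
  · rw [abs_mul, abs_of_pos (inv_pos.2 hsq)]
    gcongr
    exact hfrac.trans hsum
  · rw [abs_mul, abs_div, abs_of_nonneg hS1b.1, abs_of_pos hγ]
    gcongr
    exact hS1b.2

end Weights

/-! ### The uniform perturbation of the weights -/

section Uniform

variable {Ω : Type*} [MeasurableSpace Ω] {P : Measure Ω} [IsProbabilityMeasure P]
  {X θ : ℕ → Ω → ℝ}

lemma map_eq_restrict_of_isUniform {Y : Ω → ℝ} (hY : pdf.IsUniform Y (Set.Icc (0 : ℝ) 1) P) :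
    P.map Y = volume.restrict (Set.Icc (0 : ℝ) 1) := by
  rw [pdf.IsUniform] at hY
  rw [hY, ProbabilityTheory.cond, Real.volume_Icc]
  simp

lemma ae_mem_Icc_of_isUniform (hθm : ∀ j, Measurable (θ j))
    (hθ : ∀ j, pdf.IsUniform (θ j) (Set.Icc (0 : ℝ) 1) P) :
    ∀ᵐ ω ∂P, ∀ j, θ j ω ∈ Set.Icc (0 : ℝ) 1 := by
  refine ae_all_iff.2 fun j => ae_of_ae_map (hθm j).aemeasurable ?_
  rw [map_eq_restrict_of_isUniform (hθ j)]
  exact ae_restrict_mem measurableSet_Icc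

lemma lintegral_rpow_of_isUniform {Y : Ω → ℝ} (hYm : Measurable Y)
    (hY : pdf.IsUniform Y (Set.Icc (0 : ℝ) 1) P) {a : ℝ} (ha : 0 ≤ a) :
    ∫⁻ ω, ENNReal.ofReal (Y ω ^ a) ∂P = ENNReal.ofReal (1 / (a + 1)) := by
  have hm : Measurable fun y : ℝ => ENNReal.ofReal (y ^ a) := by fun_prop
  rw [← lintegral_map hm hYm, map_eq_restrict_of_isUniform hY,
    restrict_Ioc_eq_restrict_Icc.symm,
    ← ofReal_integral_eq_lintegral_ofReal, ← intervalIntegral.integral_of_le zero_le_one,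
    integral_rpow (Or.inl (by linarith)), Real.one_rpow, Real.zero_rpow (by linarith), sub_zero]
  · exact (intervalIntegrable_iff_integrableOn_Ioc_of_le zero_le_one).1
      (intervalIntegral.intervalIntegrable_rpow' (by linarith))
  · refine (ae_restrict_mem measurableSet_Ioc).mono fun x hx => ?_
    exact Real.rpow_nonneg hx.1.le a

/-- Conditionally on the sample, the perturbation of the weights has bounded mean. -/
lemma measureReal_sum_rpow_mul_ge_le (hXm : ∀ i, Measurable (X i)) (hθm : ∀ j, Measurable (θ j))
    (hθ : ∀ j, pdf.IsUniform (θ j) (Set.Icc (0 : ℝ) 1) P)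
    (hXθ : IndepFun (fun ω i => X i ω) (fun ω j => θ j ω) P)
    {n k : ℕ} {a γ : ℝ} (ha : 0 ≤ a) (hγ : 0 < γ) {c : ℝ} (hc : 0 < c) :
    P.real {ω | ((∀ j ∈ Finset.Icc 1 k, 0 ≤ logSpacing (fun i : Fin n => X i ω) j) ∧
        hillSum (fun i : Fin n => X i ω) k ≤ 2 * γ * k) ∧
      c ≤ ∑ j ∈ Finset.Icc 1 k,
        θ j ω ^ a * (4 + 2 / γ * logSpacing (fun i : Fin n => X i ω) j)} ≤
      8 * k / (a + 1) / c := by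
  let A : Set (Fin n → ℝ) := {x | (∀ j ∈ Finset.Icc 1 k, 0 ≤ logSpacing x j) ∧
    hillSum x k ≤ 2 * γ * k}
  have hA : MeasurableSet A := measurableSet_goodSample n k γ
  -- Restricting to good samples makes `∑ g j` at most `4 k + (2/γ) * 2 γ k = 8 k` surely, so
  -- independence and the mean `1 / (a + 1)` bound the expectation without integrability of the
  -- `T_j`.
  let g : ℕ → (Fin n → ℝ) → ENNReal := fun j =>
    A.indicator fun x => ENNReal.ofReal (4 + 2 / γ * logSpacing x j)
  have hg : ∀ j, Measurable (g j) := fun j =>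
    (((measurable_logSpacing n j).const_mul _).const_add _).ennreal_ofReal.indicator hA
  have hXv : Measurable fun ω (i : Fin n) => X i ω := measurable_pi_lambda _ fun i => hXm i
  have hgX : ∀ j, Measurable fun ω => g j fun i : Fin n => X i ω := fun j => (hg j).comp hXv
  have hθa : ∀ j, Measurable fun ω => ENNReal.ofReal (θ j ω ^ a) := fun j =>
    ((hθm j).pow_const a).ennreal_ofReal
  let V : Ω → ENNReal := fun ω => ∑ j ∈ Finset.Icc 1 k,
    ENNReal.ofReal (θ j ω ^ a) * g j fun i : Fin n => X i ω
  have hV : Measurable V := Finset.measurable_fun_sum _ fun j _ => (hθa j).mul (hgX j)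
  have hind : ∀ j, IndepFun (fun ω => ENNReal.ofReal (θ j ω ^ a))
      (fun ω => g j fun i : Fin n => X i ω) P := by
    intro j
    have h1 : Measurable fun x : ℕ → ℝ => g j fun i : Fin n => x i :=
      (hg j).comp (measurable_pi_lambda _ fun i => measurable_pi_apply _)
    have h2 : Measurable fun t : ℕ → ℝ => ENNReal.ofReal (t j ^ a) :=
      ((measurable_pi_apply j).pow_const a).ennreal_ofReal
    exact (hXθ.comp h1 h2).symm
  have hsum : ∀ x, ∑ j ∈ Finset.Icc 1 k, g j x ≤ ENNReal.ofReal (8 * k) := by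
    intro x
    by_cases hx : x ∈ A
    · simp only [g, Set.indicator_of_mem hx]
      rw [← ENNReal.ofReal_sum_of_nonneg fun j hj => by
        have := hx.1 j hj
        positivity]
      refine ENNReal.ofReal_le_ofReal ?_
      rw [Finset.sum_add_distrib, ← Finset.mul_sum]
      have h2 : 2 / γ * hillSum x k ≤ 4 * k := by
        rw [div_mul_eq_mul_div, div_le_iff₀ hγ]
        linarith [hx.2]
      have h3 : ∑ _j ∈ Finset.Icc 1 k, (4 : ℝ) = 4 * k := by simp [mul_comm]
      rw [h3]
      change 4 * (k : ℝ) + 2 / γ * hillSum x k ≤ 8 * k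
      linarith
    · simp [g, Set.indicator_of_notMem hx]
  have hint : ∫⁻ ω, V ω ∂P ≤ ENNReal.ofReal (8 * k / (a + 1)) := by
    calc ∫⁻ ω, V ω ∂P = ∑ j ∈ Finset.Icc 1 k,
          ENNReal.ofReal (1 / (a + 1)) * ∫⁻ ω, g j (fun i : Fin n => X i ω) ∂P := by
          change ∫⁻ ω, ∑ j ∈ Finset.Icc 1 k, _ ∂P = _
          have hm : ∀ j, Measurable fun ω =>
              ENNReal.ofReal (θ j ω ^ a) * g j fun i : Fin n => X i ω := fun j =>
            (hθa j).mul (hgX j)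
          rw [lintegral_finsetSum _ fun j _ => hm j]
          refine Finset.sum_congr rfl fun j _ => ?_
          rw [← lintegral_rpow_of_isUniform (hθm j) (hθ j) ha]
          exact lintegral_mul_eq_lintegral_mul_lintegral_of_indepFun (hθa j) (hgX j) (hind j)
      _ = ENNReal.ofReal (1 / (a + 1)) *
          ∫⁻ ω, ∑ j ∈ Finset.Icc 1 k, g j (fun i : Fin n => X i ω) ∂P := by
          rw [lintegral_finsetSum _ fun j _ => hgX j, Finset.mul_sum]
      _ ≤ ENNReal.ofReal (1 / (a + 1)) * ∫⁻ _, ENNReal.ofReal (8 * k) ∂P := by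
          gcongr with ω
          exact hsum _
      _ = ENNReal.ofReal (8 * k / (a + 1)) := by
          rw [lintegral_const, measure_univ, mul_one, ← ENNReal.ofReal_mul (by positivity)]
          congr 1
          ring
  have hmk := meas_ge_le_lintegral_div (μ := P) hV.aemeasurable
    (ε := ENNReal.ofReal c) (by simpa using hc) ENNReal.ofReal_ne_top
  refine ENNReal.toReal_le_of_le_ofReal (by positivity) ?_
  rw [ENNReal.ofReal_div_of_pos hc]
  refine (measure_mono_ae ?_).trans (hmk.trans (ENNReal.div_le_div_right hint _))
  filter_upwards [ae_mem_Icc_of_isUniform hθm hθ] with ω hω hmem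
  obtain ⟨hgood, hcle⟩ := hmem
  refine (ENNReal.ofReal_le_ofReal hcle).trans (le_of_eq ?_)
  have hx : (fun i : Fin n => X i ω) ∈ A := hgood
  rw [ENNReal.ofReal_sum_of_nonneg fun j hj => ?_]
  · refine Finset.sum_congr rfl fun j _ => ?_
    simp only [g, Set.indicator_of_mem hx]
    rw [ENNReal.ofReal_mul (Real.rpow_nonneg (hω j).1 a)]
  · have h1 := hgood.1 j hj
    have h2 := Real.rpow_nonneg (hω j).1 a
    positivity

end Uniform

/-! ### Measurability of the estimator -/

section Measurability

variable {Ω : Type*} [MeasurableSpace Ω] {X θ : ℕ → Ω → ℝ} {r lam : Ω → ℝ}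

lemma measurable_normWeight (hθm : ∀ j, Measurable (θ j)) (k : ℕ) (a : ℝ) (j : ℕ) :
    Measurable fun ω => normWeight k a (fun j => θ j ω) j := by
  have h : ∀ i, Measurable fun ω => weight k a (fun j => θ j ω) i := fun i =>
    (((hθm i).pow_const a).mul_const _).const_sub _
  exact (h j).div (Finset.measurable_fun_sum _ fun i _ => h i)

lemma measurable_covariate (hr : Measurable r) (k j : ℕ) :
    Measurable fun ω => covariate k (r ω) j :=
  measurable_const.pow hr.neg

lemma measurable_weightedMeanC (hθm : ∀ j, Measurable (θ j)) (hr : Measurable r) (k : ℕ) (a : ℝ) :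
    Measurable fun ω => weightedMeanC k a (fun j => θ j ω) (r ω) :=
  Finset.measurable_fun_sum _ fun j _ =>
    (measurable_normWeight hθm k a j).mul (measurable_covariate hr k j)

lemma measurable_gammaRW (hXm : ∀ i, Measurable (X i)) (hθm : ∀ j, Measurable (θ j))
    (hr : Measurable r) (hlam : Measurable lam) (n k : ℕ) (a : ℝ) :
    Measurable fun ω =>
      gammaRW (fun i : Fin n => X i ω) k a (fun j => θ j ω) (r ω) (lam ω) := by
  have hT : ∀ j, Measurable fun ω => logSpacing (fun i : Fin n => X i ω) j := fun j =>
    (measurable_logSpacing n j).comp (measurable_pi_lambda _ fun i => hXm i)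
  have hW := measurable_normWeight hθm k a
  have hC := measurable_covariate hr k
  have hS := measurable_weightedMeanC hθm hr k a
  refine (Finset.measurable_fun_sum _ fun j _ => (hW j).mul (hT j)).sub (Measurable.mul ?_ hS)
  exact (Finset.measurable_fun_sum _ fun j _ => ((hW j).mul ((hC j).sub hS)).mul (hT j)).div
    (((hlam.const_mul _).add (Finset.measurable_fun_sum _ fun j _ =>
      (hW j).mul ((hC j).pow_const 2))).sub (hS.pow_const 2))

end Measurability

/-! ### Asymptotic normality of the weighted estimator -/

theorem corollary2
    {Ω : Type*} [MeasurableSpace Ω] (P : Measure Ω) [IsProbabilityMeasure P]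
    -- the Pareto-type distribution: `U(x) = x^γ ℓ(x)`, `ℓ` slowly varying and of second order
    (μ : Measure ℝ) [IsProbabilityMeasure μ] (γ : ℝ) (hγ : 0 < γ)
    (ℓ b : ℝ → ℝ) (ρ : ℝ)
    (hU : ∀ᶠ x in atTop, tailQuantile μ x = x ^ γ * ℓ x)
    (hℓ : IsSlowlyVarying ℓ)
    (hb : SecondOrderCondition ℓ b ρ)
    -- the i.i.d. sample `X 0, X 1, …` and the independent i.i.d. uniform sequence `θ_j`
    (X : ℕ → Ω → ℝ) (hXm : ∀ i, Measurable (X i)) (hXlaw : ∀ i, P.map (X i) = μ)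
    (hXind : iIndepFun X P)
    (θ : ℕ → Ω → ℝ) (hθm : ∀ j, Measurable (θ j))
    (hθlaw : ∀ j, pdf.IsUniform (θ j) (Set.Icc (0 : ℝ) 1) P)
    (hθind : iIndepFun θ P)
    (hXθ : IndepFun (fun ω i => X i ω) (fun ω j => θ j ω) P)
    -- the number `k = k(n)` of upper order statistics
    (k : ℕ → ℕ) (hk : Tendsto k atTop atTop)
    (hkn : Tendsto (fun n => (k n : ℝ) / n) atTop (𝓝 0))
    -- the exponents `α(k)`
    (α : ℕ → ℝ) (Δ : ℝ) (hΔ : 0 < Δ)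
    (hα : Tendsto (fun m => α m / m) atTop (𝓝 Δ))
    -- the consistent estimator of `ρ` and the (possibly random) penalty
    (ρhat : ℕ → Ω → ℝ) (hρm : ∀ n, Measurable (ρhat n))
    (hρ : TendstoInMeasure P ρhat atTop (fun _ => ρ))
    (lam : ℕ → Ω → ℝ) (hlam_m : ∀ n, Measurable (lam n)) (hlam : ∀ n ω, 0 ≤ lam n ω)
    -- `√k b_{n,k} → 0`, for the slope `b(n/k)` and for its estimate
    (hslope : Tendsto (fun n => Real.sqrt (k n) * b ((n : ℝ) / k n)) atTop (𝓝 0))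
    (hslope_hat : TendstoInMeasure P
      (fun n ω => Real.sqrt (k n) *
        bHat (fun i : Fin n => X i ω) (k n) (α (k n)) (fun j => θ j ω) (ρhat n ω) (lam n ω))
      atTop (fun _ => 0)) :
    TendstoInDistribution
      (fun n ω => Real.sqrt (k n) *
        (gammaRW (fun i : Fin n => X i ω) (k n) (α (k n)) (fun j => θ j ω) (ρhat n ω) (lam n ω)
          - γ) / γ)
      atTop (id : ℝ → ℝ) (fun _ => P) (gaussianReal 0 1) := by
  have hℓpos := hℓ.1
  -- Slutsky: only the difference from the normalised Hill sum has to vanish in probability.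
  refine tendstoInDistribution_of_tendstoInMeasure_sub _ _
    (tendstoInDistribution_hillSum hγ hU hℓpos hb hk hkn hslope hXm hXlaw hXind) ?_
    (fun n => (((measurable_gammaRW hXm hθm (hρm n) (hlam_m n) n (k n) (α (k n))).sub
      measurable_const).const_mul _ |>.div_const _).aemeasurable)
  have hbad := tendsto_measureReal_hillSum hγ hU hℓpos hb hk hkn hslope hXm hXlaw hXind
  rw [tendstoInMeasure_iff_measureReal_norm] at hρ hslope_hat ⊢
  intro ε hε
  have hkr : Tendsto (fun n => (k n : ℝ)) atTop atTop := tendsto_natCast_atTop_atTop.comp hk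
  -- Insert `α(k) + 1 ≥ Δ k / 2` into `8 k / (α(k) + 1)` and divide by the threshold `√k ε / 2`.
  have h2 : Tendsto (fun n => 32 / Δ / ε / √(k n : ℝ)) atTop (𝓝 0) :=
    tendsto_const_nhds.div_atTop (Real.tendsto_sqrt_atTop.comp hkr)
  -- The tolerance `ε γ / 16` makes the slope term at most `ε / 2` after the factor `8 / γ`; the
  -- tolerance `1/2` keeps the estimate of `ρ ≤ 0` below `1/2`.
  have hlim := ((hbad.add h2).add (hslope_hat (ε * γ / 16) (by positivity))).add
    (hρ (1 / 2) (by norm_num))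
  simp only [add_zero] at hlim
  refine squeeze_zero' (Eventually.of_forall fun n => measureReal_nonneg) ?_ hlim
  have hα' : ∀ᶠ n in atTop, Δ / 2 < α (k n) / k n :=
    (hα.comp hk).eventually_const_lt (half_lt_self hΔ)
  filter_upwards [hk.eventually_gt_atTop 0, hα'] with n hk0 hαn
  have hkpos : (0 : ℝ) < k n := by exact_mod_cast hk0
  have hsq : 0 < √(k n : ℝ) := Real.sqrt_pos.2 hkpos
  rw [lt_div_iff₀ hkpos] at hαn
  have hα0 : 0 ≤ α (k n) := le_trans (by positivity) hαn.le
  have hmain := measureReal_sum_rpow_mul_ge_le (n := n) (k := k n) hXm hθm hθlaw hXθ hα0 hγ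
    (c := √(k n : ℝ) * ε / 2) (by positivity)
  have hmain' : 8 * (k n : ℝ) / (α (k n) + 1) / (√(k n : ℝ) * ε / 2) ≤
      32 / Δ / ε / √(k n : ℝ) := by
    calc _ ≤ 8 * (k n : ℝ) / (Δ / 2 * k n) / (√(k n : ℝ) * ε / 2) := by
          gcongr
          linarith
      _ = _ := by
          field_simp
          norm_num
  have hnull : P.real {ω | ¬ ∀ j, θ j ω ∈ Set.Icc (0 : ℝ) 1} = 0 := by
    rw [Measure.real, ae_iff.1 (ae_mem_Icc_of_isUniform hθm hθlaw), ENNReal.toReal_zero]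
  refine (measureReal_mono (h₂ := by finiteness) ?_).trans
    ((measureReal_union_le {ω | ¬ ∀ j, θ j ω ∈ Set.Icc (0 : ℝ) 1} _).trans
      ((add_le_add hnull.le ((measureReal_union_le _ _).trans (add_le_add
        ((measureReal_union_le _ _).trans (add_le_add
          ((measureReal_union_le _ _).trans (add_le_add le_rfl (hmain.trans hmain')))
          le_rfl)) le_rfl))).trans (zero_add _).le))
  intro ω hω
  by_contra hcon
  simp only [Set.mem_union, not_or] at hcon
  obtain ⟨h01, ⟨⟨hg, hsm⟩, hbh⟩, hrh⟩ := hcon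
  have hθ01 : ∀ j, θ j ω ∈ Set.Icc (0 : ℝ) 1 := not_not.1 h01
  have hgood := not_not.1 hg
  rw [Set.mem_ofPred_eq, not_le] at hbh hrh
  have hr : ρhat n ω ≤ 1 / 2 := by
    rw [Real.norm_eq_abs] at hrh
    linarith [(abs_lt.1 hrh).2, hb.1]
  have hdet := abs_gammaRW_sub_hillSum_le (lam := lam n ω) hγ hk0 hα0 hθ01 hr hgood.1 hgood.2
  rw [sub_zero, Real.norm_eq_abs] at hbh
  have hs := not_le.1 fun h => hsm ⟨hgood, h⟩
  have h5 : (√(k n : ℝ))⁻¹ * ∑ j ∈ Finset.Icc 1 (k n), θ j ω ^ α (k n) *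
      (4 + 2 / γ * logSpacing (fun i : Fin n => X i ω) j) < ε / 2 := by
    calc _ < (√(k n : ℝ))⁻¹ * (√(k n : ℝ) * ε / 2) := by gcongr
      _ = ε / 2 := by field_simp
  have h6 : 8 / γ * |√(k n : ℝ) * bHat (fun i : Fin n => X i ω) (k n) (α (k n)) (fun j => θ j ω)
      (ρhat n ω) (lam n ω)| < ε / 2 := by
    calc _ < 8 / γ * (ε * γ / 16) := by gcongr
      _ = ε / 2 := by
        field_simp
        norm_num
  rw [Set.mem_ofPred_eq, Pi.zero_apply, sub_zero, Pi.sub_apply, Real.norm_eq_abs] at hω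
  exact absurd (hω.trans hdet) (not_le.2 (by linarith))
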